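/- Let $(W,S)$ be a Coxeter system with $S$ finite, with Coxeter matrix $(m(s,t))$ ($m(s,t)=\infty$ allowed), and let $\Gamma$ be its Coxeter diagram: the graph on $S$ with $s\neq t$ joined when $m(s,t)\ge 3$. Let $V=\mathbb{R}^{S}$ have basis the simple roots $\Delta=\{\alpha_s: s\in S\}$, with bilinear form $(\alpha_s,\alpha_t)=-\cos(\pi/m(s,t))$, and let $W$ act on $V$ by $s(v)=v-2(v,\alpha_s)\alpha_s$. Let $\Phi=\{w(\alpha_s)\}$ be the root system, $\Phi^+$ the set of roots with nonnegative coordinates in $\Delta$, and $M_\Phi$ the oriented matroid of the vector configuration $\Phi^+\subset V$; its covectors are the sign vectors $(\operatorname{sign} f(\alpha))_{\alpha\in\Phi^+}$, $f\in V^*$. A flat of $M_\Phi$ is positive if it is the zero set of a covector with all entries in $\{+,0\}$. For $J\subseteq S$ let $\Phi_J^+$ be the set of positive roots in the span of $\{\alpha_s:s\in J\}$, and $\Gamma_J$ the induced subgraph of $\Gamma$ on $J$. A matroid is connected if its ground set is nonempty and any two distinct elements are linked by a chain of elements, consecutive ones lying in a common circuit; a flat is connected if the restriction of the matroid to it is.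 A tube of $\Gamma$ is a nonempty proper subset $J\subsetneq S$ with $\Gamma_J$ connected. A base $B$ of a matroid on $E$ is circuitous if every connected flat spanned by a subset of $B$ with at least two elements is spanned by the basic circuit $C(B,e)$ (the unique circuit contained in $B\cup\{e\}$) of some $e\in E\setminus B$. Let $R=\{f\in V^*: f(\alpha_s)\ge 0 \text{ for all } s\in S\}$ and let $T=\bigcup_{w\in W}w(R)\subset V^*$ be the Tits cone; a flat $F$ of $M_\Phi$ is parabolic if $X_F\cap T$ spans $X_F$, where $X_F=\{f\in V^*: f(\alpha)=0 \text{ for all } \alpha\in F\}$. Then the following hold. (i) $J\mapsto\Phi_J^+$ is a bijection from the subsets $J\subseteq S$ to the positive flats of $M_\Phi$, and, if $W$ is infinite, every positive flat is parabolic. (ii) $J\mapsto\Phi_J^+$ restricts to a bijection from the nonempty $J\subseteq S$ with $\Gamma_J$ connected to the connected positive flats of $M_\Phi$; under it the tubes of $\Gamma$ correspond exactly to the connected positive flats other than $\Phi^+$. (iii) $\Delta$ is a circuitous base of $M_\Phi$. (iv) Let $F\subsetneq G$ be flats of $M_\Phi$, assumed to be parabolic if $W$ is infinite. If $G$ is connected,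 then the matroid quotient $G/F$ (the restriction of $M_\Phi$ to $G$, contracted by $F$) is connected. -/

import Mathlib

noncomputable section

open Set

namespace CoxeterFlats

/-! ### Matroids -/

section Matroids

variable {α V : Type*} [AddCommGroup V] [Module ℝ V]

/-- The matroid represented by a set `E` of vectors: its ground set is `E` and its independent
sets are the linearly independent subsets of `E`. -/
def vectorMatroid (E : Set V) : Matroid V :=
  (IndepMatroid.ofFinitary E (fun I => I ⊆ E ∧ LinearIndepOn ℝ id I)
    ⟨empty_subset E, linearIndepOn_empty ℝ id⟩
    (fun _ _ hJ hIJ => ⟨hIJ.trans hJ.1, hJ.2.mono hIJ⟩)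
    (by
      rintro I B ⟨hIE, hI⟩ hImax hB
      by_contra! hcon
      apply hImax
      -- every element of `B` lies in the span of `I`
      have hBI : B ⊆ (Submodule.span ℝ I : Set V) := by
        intro x hx
        by_contra hxI
        have hxI' : x ∉ I := fun h => hxI (Submodule.subset_span h)
        exact hcon x ⟨hx, hxI'⟩ (insert_subset (hB.1.1 hx) hIE) (hI.id_insert hxI)
      -- every element of `E` lies in the span of `B`
      have hEB : E ⊆ (Submodule.span ℝ B : Set V) := by
        intro x hx
        by_contra hxB
        have := hB.2 (y := insert x B)
          ⟨insert_subset hx hB.1.1, hB.1.2.id_insert hxB⟩ (subset_insert x B)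
        exact hxB (Submodule.subset_span (this (mem_insert x B)))
      refine ⟨⟨hIE, hI⟩, fun J hJ hIJ x hx => ?_⟩
      by_contra hxI
      have hspan : x ∈ Submodule.span ℝ I := Submodule.span_le.2 hBI (hEB (hJ.1 hx))
      have hins : LinearIndepOn ℝ id (insert x I) := hJ.2.mono (insert_subset hx hIJ)
      exact ((linearIndepOn_id_insert hxI).1 hins).2 hspan)
    (fun I h =>
      ⟨fun x hx => (h {x} (singleton_subset_iff.2 hx) (finite_singleton x)).1 rfl,
        linearIndepOn_of_finite I fun J hJ hJfin => (h J hJ hJfin).2⟩)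
    (fun _ hI => hI.1)).matroid

/-- A matroid is connected if it has exactly one connected component: its ground set is nonempty,
and any two of its elements are related by the reflexive and transitive closure of the relation
"lie in a common circuit". -/
def MatroidConnected (M : Matroid α) : Prop :=
  M.E.Nonempty ∧ ∀ e ∈ M.E, ∀ f ∈ M.E,
    Relation.ReflTransGen (fun x y => ∃ C, M.IsCircuit C ∧ x ∈ C ∧ y ∈ C) e f

/-- A base `B` is circuitous if every connected flat spanned by a subset of `B` with at least two
elements is spanned by the basic circuit of some `e ∈ E \ B` with respect to `B`.
(A flat spanned by one element of `B` is of rank one, so it is never spanned by a basic circuit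
in a matroid without loops and parallel elements.) -/
def IsCircuitousBase (M : Matroid α) (B : Set α) : Prop :=
  M.IsBase B ∧ ∀ I ⊆ B, I.Nontrivial → MatroidConnected (M.restrict (M.closure I)) →
    ∃ e ∈ M.E \ B, M.closure (M.fundCircuit e B) = M.closure I

end Matroids

/-! ### Graphs -/

/-- A tube of a graph: a proper nonempty set of nodes whose induced subgraph is connected. -/
def IsTube {B : Type*} (Γ : SimpleGraph B) (J : Set B) : Prop :=
  J ≠ univ ∧ J.Nonempty ∧ (Γ.induce J).Connected

/-! ### The geometric representation of a Coxeter system -/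

section Geometric

variable {B : Type*} (M : CoxeterMatrix B)

/-- The Coxeter diagram, without labels: `s` and `t` are joined when `m(s,t) ≥ 3`
(`M s t = 0` encodes `m(s,t) = ∞`). -/
def diagram : SimpleGraph B where
  Adj s t := s ≠ t ∧ (3 ≤ M s t ∨ M s t = 0)
  symm := ⟨fun s t h => ⟨h.1.symm, by rw [M.symmetric t s]; exact h.2⟩⟩
  loopless := ⟨fun _ h => h.1 rfl⟩

/-- The simple root `α_s`, a vector of the standard basis of `ℝ^S`. -/
def simpleRoot (s : B) : B →₀ ℝ := Finsupp.single s 1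

/-- The bilinear form with `(α_s, α_t) = - cos (π / m(s,t))`.  When `m(s,t) = ∞`, encoded as
`M s t = 0`, the value is `- cos 0 = - 1`, as `π / 0 = 0`. -/
def form : (B →₀ ℝ) →ₗ[ℝ] (B →₀ ℝ) →ₗ[ℝ] ℝ :=
  Finsupp.linearCombination ℝ fun s =>
    Finsupp.linearCombination ℝ fun t => -Real.cos (Real.pi / (M s t : ℝ))

theorem form_simpleRoot (s t : B) :
    form M (simpleRoot s) (simpleRoot t) = -Real.cos (Real.pi / (M s t : ℝ)) := by
  simp [form, simpleRoot]

/-- The linear functional `v ↦ 2 (v, α_s)`. -/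
def simpleCoroot (s : B) : Module.Dual ℝ (B →₀ ℝ) := (2 : ℝ) • (form M).flip (simpleRoot s)

theorem simpleCoroot_apply (s : B) (v : B →₀ ℝ) :
    simpleCoroot M s v = 2 * form M v (simpleRoot s) := by
  simp [simpleCoroot]

theorem simpleCoroot_simpleRoot (s : B) : simpleCoroot M s (simpleRoot s) = 2 := by
  rw [simpleCoroot_apply, form_simpleRoot, M.diagonal]
  simp

/-- The reflection `v ↦ v - 2 (v, α_s) α_s`. -/
def simpleReflection (s : B) : (B →₀ ℝ) ≃ₗ[ℝ] (B →₀ ℝ) :=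
  Module.reflection (simpleCoroot_simpleRoot M s)

theorem simpleReflection_apply (s : B) (v : B →₀ ℝ) :
    simpleReflection M s v = v - (2 * form M v (simpleRoot s)) • simpleRoot s := by
  rw [simpleReflection, Module.reflection_apply, simpleCoroot_apply]

/-- The simple reflections satisfy the Coxeter relations. -/
theorem isLiftable_simpleReflection : M.IsLiftable (simpleReflection M) := by
  intro s t
  by_cases hst : s = t
  · subst hst
    rw [M.diagonal, pow_one]
    ext1 v
    exact Module.involutive_reflection (simpleCoroot_simpleRoot M s) v
  have h1 : M s t ≠ 1 := M.off_diagonal s t hst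
  generalize hm : M s t = m at h1
  have hm' : M t s = m := by rw [M.symmetric t s]; exact hm
  have hfy : simpleCoroot M s (simpleRoot t) = -2 * Real.cos (Real.pi / m) := by
    rw [simpleCoroot_apply, form_simpleRoot, hm']; ring
  have hgx : simpleCoroot M t (simpleRoot s) = -2 * Real.cos (Real.pi / m) := by
    rw [simpleCoroot_apply, form_simpleRoot, hm]; ring
  obtain rfl | h0 := Nat.eq_zero_or_pos m
  · exact pow_zero _
  have hmpos : (0 : ℝ) < m := by exact_mod_cast h0
  ext1 z
  rw [simpleReflection, simpleReflection,
    Module.reflection_mul_reflection_pow_apply _ _ m z (2 * Real.cos (2 * (Real.pi / m)))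
      (by rw [hfy, hgx, Real.cos_two_mul]; ring)]
  change _ = z
  set φ : ℝ := 2 * (Real.pi / m) with hφ
  have hmφ : (m : ℝ) * φ = 2 * Real.pi := by rw [hφ]; field_simp
  obtain rfl | h2 : m = 2 ∨ 3 ≤ m := by omega
  · rw [hfy, hgx]
    have hc : Real.cos (Real.pi / (2 : ℕ)) = 0 := by
      rw [Nat.cast_ofNat, Real.cos_pi_div_two]
    have hcφ : Real.cos φ = -1 := by
      rw [hφ, Nat.cast_ofNat, mul_div_cancel₀ _ (two_ne_zero' ℝ), Real.cos_pi]
    rw [hc, hcφ]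
    norm_num
    module
  have h3 : (3 : ℝ) ≤ m := by exact_mod_cast h2
  have hsin : Real.sin φ ≠ 0 := by
    apply ne_of_gt
    apply Real.sin_pos_of_pos_of_lt_pi
    · positivity
    · have := Real.pi_pos
      nlinarith
  have hS (k : ℤ) := Polynomial.Chebyshev.S_two_mul_real_cos φ k
  obtain ⟨k, hk⟩ | ⟨k, hk⟩ := Nat.even_or_odd m
  · have e1 : ((m : ℤ) - 2) / 2 = k - 1 := by omega
    have e2 : ((m : ℤ) - 1) / 2 = k - 1 := by omega
    have hz : (Polynomial.Chebyshev.S ℝ (k - 1)).eval (2 * Real.cos φ) = 0 := by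
      have := hS (k - 1)
      have hkφ : (((k - 1 : ℤ) : ℝ) + 1) * φ = Real.pi := by
        have : (m : ℝ) = k + k := by exact_mod_cast hk
        push_cast
        rw [this] at hmφ
        linarith
      rw [hkφ, Real.sin_pi] at this
      exact (mul_eq_zero.1 this).resolve_right hsin
    rw [e1, e2, hz]
    simp
  · have e1 : ((m : ℤ) - 2) / 2 = k - 1 := by omega
    have e2 : ((m : ℤ) - 1) / 2 = k := by omega
    have e3 : ((m : ℤ) - 3) / 2 = k - 1 := by omega
    have e4 : (m : ℤ) / 2 = k := by omega
    have hz : (Polynomial.Chebyshev.S ℝ k).eval (2 * Real.cos φ) +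
        (Polynomial.Chebyshev.S ℝ (k - 1)).eval (2 * Real.cos φ) = 0 := by
      have ha := hS k
      have hb := hS (k - 1)
      have hkφ : (((k : ℤ) : ℝ) + 1) * φ = 2 * Real.pi - (((k - 1 : ℤ) : ℝ) + 1) * φ := by
        have : (m : ℝ) = 2 * k + 1 := by exact_mod_cast hk
        push_cast
        rw [this] at hmφ
        linarith
      rw [hkφ, Real.sin_two_pi_sub, ← hb] at ha
      apply (mul_eq_zero.1 _).resolve_right hsin
      linarith
    rw [e1, e2, e3, e4, hz]
    simp

end Geometric

/-! ### Roots, the matroid of the positive roots, the Tits cone and parabolic flats -/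

section System

variable {B : Type*} {M : CoxeterMatrix B} {W : Type*} [Group W] (cs : CoxeterSystem M W)

/-- The geometric representation of `W` on `V = ℝ^S`, in which `s` acts by the reflection
`v ↦ v - 2 (v, α_s) α_s`. -/
def geometricRep : W →* ((B →₀ ℝ) ≃ₗ[ℝ] (B →₀ ℝ)) :=
  cs.lift ⟨simpleReflection M, isLiftable_simpleReflection M⟩

theorem geometricRep_simple (s : B) : geometricRep cs (cs.simple s) = simpleReflection M s :=
  cs.lift_apply_simple (isLiftable_simpleReflection M) s

/-- The root system `Φ = {w(α_s)}`. -/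
def roots : Set (B →₀ ℝ) := {v | ∃ (w : W) (s : B), v = geometricRep cs w (simpleRoot s)}

/-- The positive roots: the roots with nonnegative coordinates in the basis of simple roots. -/
def posRoots : Set (B →₀ ℝ) := {v | v ∈ roots cs ∧ ∀ s, 0 ≤ v s}

/-- The matroid `M_Φ`, represented by the vector configuration of positive roots. -/
def rootMatroid : Matroid (B →₀ ℝ) := vectorMatroid (posRoots cs)

/-- The covectors of the oriented matroid `M_Φ`: the sign vectors
`(sign f(α))_{α ∈ Φ⁺}` of the linear functionals `f` on `V`. -/
def covectors : Set (posRoots cs → SignType) :=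
  range fun (f : Module.Dual ℝ (B →₀ ℝ)) (a : posRoots cs) => SignType.sign (f a)

/-- A positive flat: a flat of `M_Φ` which is the zero set of a covector all of whose entries
are `+` or `0`. -/
def IsPositiveFlat (F : Set (B →₀ ℝ)) : Prop :=
  (rootMatroid cs).IsFlat F ∧
    ∃ X ∈ covectors cs, (∀ a, X a = 1 ∨ X a = 0) ∧ F = Subtype.val '' {a | X a = 0}

/-- The standard parabolic flat `Φ_J⁺`: the positive roots in the span of `{α_s : s ∈ J}`. -/
def standardFlat (J : Set B) : Set (B →₀ ℝ) :=
  {v | v ∈ posRoots cs ∧ v ∈ Submodule.span ℝ (simpleRoot '' J)}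

/-- The Tits cone `T = ⋃ w(R)` in the dual space `V*`, on which `W` acts by
`(w f)(v) = f (w⁻¹ v)`; here `R` is the closed fundamental chamber, that is, the cone of
nonnegative combinations of the basis dual to the simple roots. -/
def titsCone : Set (Module.Dual ℝ (B →₀ ℝ)) :=
  {f | ∃ (w : W) (g : Module.Dual ℝ (B →₀ ℝ)), (∀ s, 0 ≤ g (simpleRoot s)) ∧
    ∀ v, f v = g (geometricRep cs w⁻¹ v)}

/-- The intersection subspace `X_F` of the hyperplanes `H_α = {f : f(α) = 0}`, `α ∈ F`. -/
def flatSpace (F : Set (B →₀ ℝ)) : Submodule ℝ (Module.Dual ℝ (B →₀ ℝ)) :=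
  Submodule.dualAnnihilator (Submodule.span ℝ F)

/-- A parabolic flat: a flat `F` of `M_Φ` for which the convex cone `X_F ∩ T` has full dimension
in `X_F`, that is, spans `X_F`. -/
def IsParabolicFlat (F : Set (B →₀ ℝ)) : Prop :=
  (rootMatroid cs).IsFlat F ∧
    Submodule.span ℝ ((flatSpace F : Set (Module.Dual ℝ (B →₀ ℝ))) ∩ titsCone cs) = flatSpace F

/-- The flats under consideration: all flats of `M_Φ` when `W` is finite, and the parabolic flats
when `W` is infinite. -/
def IsCoxeterFlat (F : Set (B →₀ ℝ)) : Prop :=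
  (rootMatroid cs).IsFlat F ∧ (Infinite W → IsParabolicFlat cs F)

/-- A flat is connected if the restriction of the matroid `M_Φ` to it is connected. -/
def IsConnectedFlat (F : Set (B →₀ ℝ)) : Prop :=
  MatroidConnected ((rootMatroid cs).restrict F)

/-- The matroid quotient `G / F`: restrict `M_Φ` to `G`, then contract `F`. -/
def flatQuotient (G F : Set (B →₀ ℝ)) : Matroid (B →₀ ℝ) :=
  ((rootMatroid cs).restrict G).contract F

end System

end CoxeterFlats

end

/-!
A represented matroid is connected exactly when its vectors are not distributed over two
independent subspaces, and contracting a flat `F` means working modulo `span F`. Everything is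
therefore about decompositions of sets of roots relative to a subspace.

If `Γ_K` is connected, some positive root `v` has support exactly `K`: the reflection in a node
outside the support of a root, but joined to it, adds just that node. The simple roots of `K`
together with `v` form a circuit, and they stay indecomposable modulo the span of any set of simple
roots. So `Φ_K⁺` is connected, its quotient by every smaller `Φ_J⁺` is connected, and `Φ_K⁺` is
spanned by the basic circuit of `v`. If `Γ_K` is disconnected, then so is `Φ_K⁺`, since every root
in it comes from a simple root by reflections in `K` and hence stays over one component. A positive
flat is the zero set of a dominant functional, so it is `Φ_J⁺` for the set `J` of simple roots on
which the functional vanishes.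

For arbitrary parabolic flats, the Tits cone consists of the functionals which are negative on
finitely many positive roots only: a simple reflection at which the functional is negative lowers
their number by one. A parabolic flat is thus the zero set of some functional in the Tits cone. For
nested flats `F ⊂ G` with functionals `f` and `g`, an element of `W` making `g + ε f` dominant for
small `ε > 0` also makes `g` dominant, so `F` and `G` are carried together, up to signs of roots,
to standard flats `Φ_J⁺ ⊂ Φ_K⁺`.
-/

namespace CoxeterFlats

open Set
open scoped Pointwise

/-! ### Indecomposable configurations and representable matroids -/

section Indecomposable

variable {𝕜 V V' : Type*} [Ring 𝕜] [AddCommGroup V] [Module 𝕜 V] [AddCommGroup V'] [Module 𝕜 V']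

/-- The configuration `E` is indecomposable modulo the subspace `P`: it is not distributed over two
subspaces which meet exactly in `P`. For `P = ⊥` this is connectedness of the matroid of `E`, and in
general that of its contraction by the vectors in `P`. -/
def IsIndecomposableMod (P : Submodule 𝕜 V) (E : Set V) : Prop :=
  ∀ ⦃U₁ U₂ : Submodule 𝕜 V⦄, U₁ ⊓ U₂ = P → E ⊆ (U₁ : Set V) ∪ U₂ → E ⊆ U₁ ∨ E ⊆ U₂

variable {P : Submodule 𝕜 V} {E E' : Set V}

theorem IsIndecomposableMod.superset (h : IsIndecomposableMod P E) (hE : E ⊆ E')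
    (hE' : E' ⊆ Submodule.span 𝕜 E) : IsIndecomposableMod P E' := by
  intro U₁ U₂ hU hcover
  exact (h hU (hE.trans hcover)).imp (fun h => hE'.trans (Submodule.span_le.2 h))
    (fun h => hE'.trans (Submodule.span_le.2 h))

theorem IsIndecomposableMod.sdiff (h : IsIndecomposableMod P E) (hE' : E' ⊆ P) :
    IsIndecomposableMod P (E \ E') := by
  intro U₁ U₂ hU hcover
  have subset_left : E' ⊆ U₁ := hE'.trans (hU ▸ inter_subset_left)
  have hE : E ⊆ (U₁ : Set V) ∪ U₂ :=
    (sdiff_subset_iff.1 hcover).trans (union_subset (subset_left.trans subset_union_left) le_rfl)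
  exact (h hU hE).imp sdiff_subset.trans sdiff_subset.trans

theorem isIndecomposableMod_union_neg :
    IsIndecomposableMod P (E ∪ -E) ↔ IsIndecomposableMod P E := by
  have subset_iff (T : Set V) (hT : -T = T) : E ∪ -E ⊆ T ↔ E ⊆ T := by
    rw [union_subset_iff, neg_subset, hT, and_self]
  have neg_union (U₁ U₂ : Submodule 𝕜 V) : -((U₁ : Set V) ∪ U₂) = (U₁ : Set V) ∪ U₂ := by
    rw [union_neg, neg_coe_set, neg_coe_set]
  simp only [IsIndecomposableMod, subset_iff _ (neg_coe_set), subset_iff _ (neg_union _ _)]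

theorem IsIndecomposableMod.image {P : Submodule 𝕜 V'} (f : V →ₗ[𝕜] V')
    (h : IsIndecomposableMod (P.comap f) E) : IsIndecomposableMod P (f '' E) := by
  intro U₁ U₂ hU hcover
  rw [image_subset_iff] at hcover
  rw [image_subset_iff, image_subset_iff]
  exact h (U₁ := U₁.comap f) (U₂ := U₂.comap f) (by rw [← Submodule.comap_inf, hU]) hcover

theorem isIndecomposableMod_image_iff {P : Submodule 𝕜 V'} (e : V ≃ₗ[𝕜] V') :
    IsIndecomposableMod P (e '' E) ↔ IsIndecomposableMod (P.comap e.toLinearMap) E := by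
  refine ⟨fun h => ?_, fun h => h.image e.toLinearMap⟩
  rw [← e.symm_image_image E]
  refine IsIndecomposableMod.image e.symm.toLinearMap ?_
  rwa [← Submodule.comap_comp, e.comp_symm, Submodule.comap_id]

end Indecomposable

section Representations

variable {𝕜 α V : Type*} [DivisionRing 𝕜] [AddCommGroup V] [Module 𝕜 V]

/-- The matroid `N` is represented over `𝕜` by the family `v`: a set of elements of `N` is
independent in `N` exactly when `v` is linearly independent on it. The values of `v` off the ground
set are irrelevant. -/
def IsRepresentedBy (𝕜 : Type*) {α V : Type*} [DivisionRing 𝕜] [AddCommGroup V] [Module 𝕜 V]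
    (N : Matroid α) (v : α → V) : Prop :=
  ∀ I, N.Indep I ↔ I ⊆ N.E ∧ LinearIndepOn 𝕜 v I

variable {N : Matroid α} {v : α → V} {I X Y F : Set α} {e : α}

theorem IsRepresentedBy.span_image_eq_of_isBasis (hN : IsRepresentedBy 𝕜 N v)
    (hI : N.IsBasis I X) : Submodule.span 𝕜 (v '' I) = Submodule.span 𝕜 (v '' X) := by
  refine le_antisymm (Submodule.span_mono (image_mono hI.subset)) (Submodule.span_le.2 ?_)
  rintro _ ⟨x, hx, rfl⟩
  refine ((hN I).1 hI.indep).2.mem_span_iff.2 fun hxI => ?_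
  exact hI.mem_of_insert_indep hx
    ((hN _).2 ⟨insert_subset (hI.subset_ground hx) ((hN I).1 hI.indep).1, hxI⟩)

theorem IsRepresentedBy.mem_closure_iff (hN : IsRepresentedBy 𝕜 N v) (hX : X ⊆ N.E) :
    e ∈ N.closure X ↔ e ∈ N.E ∧ v e ∈ Submodule.span 𝕜 (v '' X) := by
  obtain ⟨I, hI⟩ := N.exists_isBasis X hX
  obtain ⟨hIE, hIv⟩ := (hN I).1 hI.indep
  rw [← hI.closure_eq_closure, hI.indep.mem_closure_iff', ← hN.span_image_eq_of_isBasis hI,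
    hIv.mem_span_iff]
  exact and_congr_right fun he => imp_congr_left <|
    (hN _).trans <| and_iff_right <| insert_subset he hIE

theorem IsRepresentedBy.restrict (hN : IsRepresentedBy 𝕜 N v) (hX : X ⊆ N.E) :
    IsRepresentedBy 𝕜 (N.restrict X) v := fun I => by
  rw [Matroid.restrict_indep_iff, hN I, Matroid.restrict_ground_eq]
  exact ⟨fun h => ⟨h.2, h.1.2⟩, fun h => ⟨⟨h.1.trans hX, h.2⟩, h.1⟩⟩

theorem IsRepresentedBy.contract (hN : IsRepresentedBy 𝕜 N v) (hF : F ⊆ N.E) :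
    IsRepresentedBy 𝕜 (N.contract F) ((Submodule.span 𝕜 (v '' F)).mkQ ∘ v) := fun I => by
  obtain ⟨K, hK⟩ := N.exists_isBasis F hF
  obtain ⟨hKE, hKv⟩ := (hN K).1 hK.indep
  have indep_iff (hd : Disjoint F I) : LinearIndepOn 𝕜 v (I ∪ K) ↔
      LinearIndepOn 𝕜 ((Submodule.span 𝕜 (v '' K)).mkQ ∘ v) I := by
    rw [union_comm, hKv.quotient_iff_union (hd.mono_left hK.subset)]
  rw [hK.contract_indep_iff, hN, Matroid.contract_ground, subset_sdiff, disjoint_comm (a := I),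
    ← hN.span_image_eq_of_isBasis hK, union_subset_iff, and_iff_left hKE, and_assoc,
    and_assoc, and_comm (b := Disjoint F I)]
  exact and_congr_right fun _ => and_congr_right indep_iff

theorem IsRepresentedBy.subset_or_subset_of_isCircuit (hN : IsRepresentedBy 𝕜 N v) {C : Set α}
    (hC : N.IsCircuit C) {U₁ U₂ : Submodule 𝕜 V} (hU : Disjoint U₁ U₂)
    (hCU : C ⊆ v ⁻¹' (U₁ ∪ U₂)) : C ⊆ v ⁻¹' U₁ ∨ C ⊆ v ⁻¹' U₂ := by
  by_contra! hcon
  have linearIndepOn_inter (U : Submodule 𝕜 V) (h : ¬ C ⊆ v ⁻¹' U) :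
      LinearIndepOn 𝕜 v (C ∩ v ⁻¹' U) :=
    ((hN _).1 (hC.ssubset_indep (inter_ssubset_left_iff.2 h))).2
  have span_le (U : Submodule 𝕜 V) : Submodule.span 𝕜 (v '' (C ∩ v ⁻¹' U)) ≤ U :=
    Submodule.span_le.2 (image_subset_iff.2 inter_subset_right)
  have hunion := (linearIndepOn_inter U₁ hcon.1).union (linearIndepOn_inter U₂ hcon.2)
    (hU.mono (span_le U₁) (span_le U₂))
  rw [← inter_union_distrib_left, ← preimage_union, inter_eq_left.2 hCU] at hunion
  exact hC.not_indep ((hN C).2 ⟨hC.subset_ground, hunion⟩)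

theorem IsRepresentedBy.disjoint_span_image (hN : IsRepresentedBy 𝕜 N v) (hX : X ⊆ N.E)
    (hY : Y ⊆ N.E) (hXY : Disjoint X Y)
    (hC : ∀ C, N.IsCircuit C → C ⊆ X ∪ Y → C ⊆ X ∨ C ⊆ Y) :
    Disjoint (Submodule.span 𝕜 (v '' X)) (Submodule.span 𝕜 (v '' Y)) := by
  obtain ⟨I, hI⟩ := N.exists_isBasis X hX
  obtain ⟨J, hJ⟩ := N.exists_isBasis Y hY
  have hIJ : N.Indep (I ∪ J) := by
    rw [Matroid.indep_iff_forall_subset_not_isCircuit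
      (union_subset (hI.subset.trans hX) (hJ.subset.trans hY))]
    intro C hCIJ hCirc
    rcases hC C hCirc (hCIJ.trans (union_subset_union hI.subset hJ.subset)) with h | h
    · exact hCirc.not_indep (hI.indep.subset
        ((hXY.mono h hJ.subset).subset_left_of_subset_union hCIJ))
    · exact hCirc.not_indep (hJ.indep.subset
        ((hXY.symm.mono h hI.subset).subset_right_of_subset_union hCIJ))
  rw [← hN.span_image_eq_of_isBasis hI, ← hN.span_image_eq_of_isBasis hJ]
  exact ((linearIndepOn_union_iff (hXY.mono hI.subset hJ.subset)).1 ((hN _).1 hIJ).2).2.2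

theorem IsRepresentedBy.subset_preimage_of_matroidConnected (hN : IsRepresentedBy 𝕜 N v)
    (hv : ∀ x ∈ N.E, v x ≠ 0) (hconn : MatroidConnected N) {U₁ U₂ : Submodule 𝕜 V}
    (hU : Disjoint U₁ U₂) (hE : N.E ⊆ v ⁻¹' (U₁ ∪ U₂)) (he : e ∈ N.E) (heU : v e ∈ U₁) :
    N.E ⊆ v ⁻¹' U₁ := by
  intro f hf
  induction hconn.2 e he f hf with
  | refl => exact heU
  | tail _ hxy ih =>
    obtain ⟨C, hC, hx, hy⟩ := hxy
    have hxE := hC.subset_ground hx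
    rcases hN.subset_or_subset_of_isCircuit hC hU (hC.subset_ground.trans hE) with h | h
    · exact h hy
    · exact absurd (Submodule.disjoint_def.1 hU _ (ih hxE) (h hx)) (hv _ hxE)

theorem IsRepresentedBy.matroidConnected_of_isIndecomposableMod (hN : IsRepresentedBy 𝕜 N v)
    (hv : ∀ x ∈ N.E, v x ≠ 0) (hne : N.E.Nonempty)
    (h : IsIndecomposableMod (⊥ : Submodule 𝕜 V) (v '' N.E)) : MatroidConnected N := by
  refine ⟨hne, fun e he f hf => ?_⟩
  set K : Set α :=
    {x ∈ N.E | Relation.ReflTransGen (fun x y => ∃ C, N.IsCircuit C ∧ x ∈ C ∧ y ∈ C) e x}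
  have hKE : K ⊆ N.E := sep_subset _ _
  have circuit_subset (C) (hC : N.IsCircuit C) : C ⊆ K ∨ C ⊆ N.E \ K := by
    by_contra! hcon
    obtain ⟨⟨x, hx, hxK⟩, ⟨y, hy, hyK⟩⟩ := hcon.imp not_subset.1 not_subset.1
    have hyK : y ∈ K := by_contra fun h => hyK ⟨hC.subset_ground hy, h⟩
    exact hxK ⟨hC.subset_ground hx, hyK.2.tail ⟨C, hC, hy, hx⟩⟩
  have hd := hN.disjoint_span_image hKE sdiff_subset disjoint_sdiff_right
    fun C hC _ => circuit_subset C hC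
  have hcover : v '' N.E ⊆ (Submodule.span 𝕜 (v '' K) : Set V) ∪
      Submodule.span 𝕜 (v '' (N.E \ K)) := by
    rw [← union_sdiff_cancel hKE, image_union, union_sdiff_cancel hKE]
    exact union_subset_union Submodule.subset_span Submodule.subset_span
  have heK : v e ∈ v '' K := mem_image_of_mem v ⟨he, .refl⟩
  rcases h hd.eq_bot hcover with h | h
  · by_contra hfe
    have hfK : v f ∈ v '' (N.E \ K) := mem_image_of_mem v ⟨hf, fun h => hfe h.2⟩
    exact hv f hf (Submodule.disjoint_def.1 hd _ (h (mem_image_of_mem v hf))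
      (Submodule.subset_span hfK))
  · exact absurd (Submodule.disjoint_def.1 hd _ (Submodule.subset_span heK)
      (h (mem_image_of_mem v he))) (hv e he)

theorem IsRepresentedBy.matroidConnected_iff (hN : IsRepresentedBy 𝕜 N v)
    (hv : ∀ e ∈ N.E, v e ≠ 0) :
    MatroidConnected N ↔ N.E.Nonempty ∧ IsIndecomposableMod (⊥ : Submodule 𝕜 V) (v '' N.E) := by
  refine ⟨fun hconn => ⟨hconn.1, fun U₁ U₂ hU hE => ?_⟩, fun ⟨hne, h⟩ =>
    hN.matroidConnected_of_isIndecomposableMod hv hne h⟩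
  simp only [image_subset_iff] at hE ⊢
  have hd : Disjoint U₁ U₂ := disjoint_iff.2 hU
  obtain ⟨e, he⟩ := hconn.1
  exact (hE he).imp (hN.subset_preimage_of_matroidConnected hv hconn hd hE he)
    (hN.subset_preimage_of_matroidConnected hv hconn hd.symm
      (hE.trans_eq (by rw [union_comm])) he)

end Representations

section VectorMatroid

variable {V : Type*} [AddCommGroup V] [Module ℝ V] {E F G : Set V}

theorem isRepresentedBy_vectorMatroid : IsRepresentedBy ℝ (vectorMatroid E) id := fun I => by
  simp [vectorMatroid, IndepMatroid.ofFinitary]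

theorem mem_closure_vectorMatroid_iff {X : Set V} (hX : X ⊆ E) {e : V} :
    e ∈ (vectorMatroid E).closure X ↔ e ∈ E ∧ e ∈ Submodule.span ℝ X := by
  rw [isRepresentedBy_vectorMatroid.mem_closure_iff hX, image_id]
  rfl

theorem isFlat_vectorMatroid_iff :
    (vectorMatroid E).IsFlat F ↔ F ⊆ E ∧ ∀ e ∈ E, e ∈ Submodule.span ℝ F → e ∈ F := by
  refine ⟨fun h => ⟨h.subset_ground, fun e he hs => ?_⟩, fun ⟨hF, h⟩ => ?_⟩
  · rw [← h.closure]
    exact (mem_closure_vectorMatroid_iff h.subset_ground).2 ⟨he, hs⟩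
  · rw [Matroid.isFlat_iff_closure_eq]
    ext e
    rw [mem_closure_vectorMatroid_iff hF]
    exact ⟨fun he => h e he.1 he.2, fun he => ⟨hF he, Submodule.subset_span he⟩⟩

theorem matroidConnected_restrict_vectorMatroid_iff (h0 : 0 ∉ F) (hF : F ⊆ E) :
    MatroidConnected ((vectorMatroid E).restrict F) ↔
      F.Nonempty ∧ IsIndecomposableMod (⊥ : Submodule ℝ V) F := by
  rw [(isRepresentedBy_vectorMatroid.restrict hF).matroidConnected_iff
    fun e he h => h0 (h ▸ he), image_id]
  rfl

theorem matroidConnected_restrict_contract_vectorMatroid (hF : (vectorMatroid E).IsFlat F)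
    (hG : G ⊆ E) (hFG : F ⊂ G) (h : IsIndecomposableMod (Submodule.span ℝ F) G) :
    MatroidConnected (((vectorMatroid E).restrict G).contract F) := by
  have hrep := (isRepresentedBy_vectorMatroid.restrict hG).contract (F := F) hFG.subset
  rw [image_id] at hrep
  refine (hrep.matroidConnected_iff fun e he h0 => ?_).2 ⟨nonempty_of_ssubset hFG, ?_⟩
  · exact he.2 ((isFlat_vectorMatroid_iff.1 hF).2 e (hG he.1) (by simpa using h0))
  · refine IsIndecomposableMod.image _ ?_
    rw [Submodule.comap_bot, Submodule.ker_mkQ]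
    exact h.sdiff Submodule.subset_span

end VectorMatroid

/-! ### Positivity of roots -/

section SimpleRoots

variable {B : Type*}

theorem span_image_simpleRoot (J : Set B) :
    Submodule.span ℝ (simpleRoot '' J) = Finsupp.supported ℝ ℝ J :=
  (Finsupp.supported_eq_span_single ℝ J).symm

theorem simpleRoot_mem_supported_iff {J : Set B} {s : B} :
    simpleRoot s ∈ Finsupp.supported ℝ ℝ J ↔ s ∈ J := by
  simp [Finsupp.mem_supported, simpleRoot]

theorem supported_le_iff {J : Set B} {U : Submodule ℝ (B →₀ ℝ)} :
    Finsupp.supported ℝ ℝ J ≤ U ↔ ∀ s ∈ J, simpleRoot s ∈ U := by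
  rw [← span_image_simpleRoot, Submodule.span_le, image_subset_iff]
  rfl

theorem map_eq_sum_simpleRoot (f : Module.Dual ℝ (B →₀ ℝ)) (v : B →₀ ℝ) :
    f v = v.sum fun s a => a * f (simpleRoot s) := by
  have hsmul (s : B) (a : ℝ) : Finsupp.single s a = a • simpleRoot s := by simp [simpleRoot]
  conv_lhs => rw [← v.sum_single]
  simp only [Finsupp.sum, map_sum, hsmul, map_smul, smul_eq_mul]

theorem isIndecomposableMod_insert_simpleRoot (v : B →₀ ℝ) (J : Set B) :
    IsIndecomposableMod (Finsupp.supported ℝ ℝ J) (insert v (simpleRoot '' v.support)) := by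
  classical
  have filter_mem (U : Submodule ℝ (B →₀ ℝ)) (p : B → Prop) [DecidablePred p]
      (hp : ∀ s ∈ v.support, p s → simpleRoot s ∈ U) : v.filter p ∈ U :=
    (supported_le_iff (J := ↑(v.filter p).support)).2
      (fun s hs => by
        obtain ⟨hs, hps⟩ := Finset.mem_filter.1 (Finsupp.support_filter p v ▸ hs)
        exact hp s hs hps)
      (Finsupp.mem_supported_support ℝ _)
  have subset_of_mem (U₁ U₂ : Submodule ℝ (B →₀ ℝ)) (hU : U₁ ⊓ U₂ = Finsupp.supported ℝ ℝ J)
      (hcover : simpleRoot '' (v.support : Set B) ⊆ (U₁ : Set (B →₀ ℝ)) ∪ U₂) (hv : v ∈ U₁) :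
      insert v (simpleRoot '' v.support) ⊆ (U₁ : Set (B →₀ ℝ)) := by
    have rest_mem₁ : v.filter (simpleRoot · ∉ U₁) ∈ U₁ := by
      rw [← v.filter_add_filter_not (simpleRoot · ∈ U₁)] at hv
      exact (U₁.add_mem_iff_right (filter_mem U₁ _ fun _ _ hs => hs)).1 hv
    have rest_mem₂ : v.filter (simpleRoot · ∉ U₁) ∈ U₂ :=
      filter_mem U₂ _ fun s hs hs₁ => (hcover (mem_image_of_mem _ hs)).resolve_left hs₁
    have rest_support := (Finsupp.mem_supported' ℝ _).1 (hU.le ⟨rest_mem₁, rest_mem₂⟩)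
    refine insert_subset hv (image_subset_iff.2 fun s hs => by_contra fun hs₁ => ?_)
    have hsJ : s ∉ J := fun hsJ => hs₁ (hU.ge (simpleRoot_mem_supported_iff.2 hsJ)).1
    exact Finsupp.mem_support_iff.1 hs
      ((Finsupp.filter_apply_pos (simpleRoot · ∉ U₁) v hs₁).symm.trans (rest_support s hsJ))
  intro U₁ U₂ hU hcover
  rw [insert_subset_iff] at hcover
  exact hcover.1.imp (subset_of_mem U₁ U₂ hU hcover.2)
    (subset_of_mem U₂ U₁ (inf_comm U₂ U₁ ▸ hU) (union_comm _ _ ▸ hcover.2))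

end SimpleRoots

section Form

variable {B : Type*} (M : CoxeterMatrix B)

theorem form_simpleRoot_self (s : B) : form M (simpleRoot s) (simpleRoot s) = 1 := by
  simp [form_simpleRoot]

theorem form_comm (u v : B →₀ ℝ) : form M u v = form M v u := by
  suffices form M = (form M).flip from LinearMap.congr_fun₂ this u v
  ext s t
  simp [form, M.symmetric s t]

theorem form_simpleReflection (s : B) (u v : B →₀ ℝ) :
    form M (simpleReflection M s u) (simpleReflection M s v) = form M u v := by
  simp only [simpleReflection_apply, map_sub, map_smul, LinearMap.sub_apply, LinearMap.smul_apply,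
    smul_eq_mul, form_simpleRoot_self]
  rw [form_comm M (simpleRoot s) v]
  ring

theorem simpleReflection_simpleRoot_self (s : B) :
    simpleReflection M s (simpleRoot s) = -simpleRoot s :=
  Module.reflection_apply_self (simpleCoroot_simpleRoot M s)

theorem simpleReflection_simpleReflection (s : B) (v : B →₀ ℝ) :
    simpleReflection M s (simpleReflection M s v) = v :=
  Module.involutive_reflection (simpleCoroot_simpleRoot M s) v

theorem simpleReflection_apply_of_ne {s r : B} (h : r ≠ s) (v : B →₀ ℝ) :
    simpleReflection M s v r = v r := by
  simp [simpleReflection_apply, simpleRoot, h.symm]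

theorem pi_div_mem_Icc {m : ℕ} (hm : m ≠ 1) : Real.pi / m ∈ Icc 0 (Real.pi / 2) := by
  refine ⟨by positivity, ?_⟩
  rcases Nat.eq_zero_or_pos m with rfl | h₀
  · simp only [Nat.cast_zero, div_zero]
    positivity
  · have : (2 : ℝ) ≤ m := by exact_mod_cast (by omega : 2 ≤ m)
    gcongr

theorem form_simpleRoot_nonpos {s t : B} (h : s ≠ t) :
    form M (simpleRoot s) (simpleRoot t) ≤ 0 := by
  obtain ⟨h₀, h₁⟩ := pi_div_mem_Icc (M.off_diagonal s t h)
  rw [form_simpleRoot, neg_nonpos]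
  exact Real.cos_nonneg_of_mem_Icc ⟨by linarith [Real.pi_nonneg], h₁⟩

theorem form_simpleRoot_eq_zero {s t : B} (hst : s ≠ t) (h : ¬ (diagram M).Adj s t) :
    form M (simpleRoot s) (simpleRoot t) = 0 := by
  have h₁ := M.off_diagonal s t hst
  have h₂ : M s t = 2 := by
    simp only [diagram, hst, ne_eq, not_false_eq_true, true_and, not_or] at h
    omega
  simp [form_simpleRoot, h₂]

theorem form_simpleRoot_neg {s t : B} (h : (diagram M).Adj s t) :
    form M (simpleRoot s) (simpleRoot t) < 0 := by
  rw [form_simpleRoot, neg_lt_zero]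
  rcases h.2 with h₃ | h₀
  · have h₃ : (3 : ℝ) ≤ M s t := by exact_mod_cast h₃
    have hpi := Real.pi_pos
    refine Real.cos_pos_of_mem_Ioo ⟨?_, ?_⟩
    · linarith [(by positivity : 0 ≤ Real.pi / (M s t : ℝ))]
    · gcongr
      linarith
  · simp [h₀]

variable {M}

theorem simpleReflection_mem_supported {K : Set B} {s : B} (hs : s ∈ K) {v : B →₀ ℝ}
    (hv : v ∈ Finsupp.supported ℝ ℝ K) :
    simpleReflection M s v ∈ Finsupp.supported ℝ ℝ K := by
  rw [simpleReflection_apply]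
  exact sub_mem hv (Submodule.smul_mem _ _ (simpleRoot_mem_supported_iff.2 hs))

end Form

section Dihedral

open Polynomial in
theorem chebyshevU_eval_cos_pi_div_nonneg {m : ℕ} (hm : m ≠ 1) {n : ℤ} (hn : 0 ≤ n + 1)
    (hnm : m ≠ 0 → n + 1 ≤ m) : 0 ≤ (Chebyshev.U ℝ n).eval (Real.cos (Real.pi / m)) := by
  have hn' : (0 : ℝ) ≤ n + 1 := by exact_mod_cast hn
  rcases eq_or_ne m 0 with rfl | h₀
  · simpa using hn'
  have hnm : (n + 1 : ℝ) ≤ m := by exact_mod_cast hnm h₀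
  have h₂ : (2 : ℝ) ≤ m := by exact_mod_cast (by omega : 2 ≤ m)
  have hpi := Real.pi_pos
  have hsin : 0 < Real.sin (Real.pi / m) :=
    Real.sin_pos_of_pos_of_lt_pi (by positivity) (div_lt_self hpi (by linarith))
  refine nonneg_of_mul_nonneg_left ?_ hsin
  rw [Chebyshev.U_real_cos]
  refine Real.sin_nonneg_of_nonneg_of_le_pi (by positivity) ?_
  rw [← mul_div_assoc, div_le_iff₀ (by linarith), mul_comm]
  gcongr

variable {B : Type*} {M : CoxeterMatrix B} {W : Type*} [Group W] (cs : CoxeterSystem M W)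

theorem exists_eq_mul_alternatingWord {w : W} {s : B} (hs : ¬ cs.IsRightDescent w s) (t : B) :
    ∃ (v : W) (k : ℕ), w = v * cs.wordProd (CoxeterSystem.alternatingWord s t k) ∧
      cs.length v + k = cs.length w ∧ ¬ cs.IsRightDescent v s ∧ ¬ cs.IsRightDescent v t := by
  induction hn : cs.length w using Nat.strong_induction_on generalizing w s t with
  | _ n ih =>
  by_cases ht : cs.IsRightDescent w t
  · have hlen := cs.isRightDescent_iff.1 ht
    obtain ⟨v, k, hwv, hvk, hvt, hvs⟩ := ih _ (by omega)
      (cs.isRightDescent_iff_not_isRightDescent_mul.1 ht) s rfl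
    refine ⟨v, k + 1, ?_, by omega, hvs, hvt⟩
    rw [CoxeterSystem.alternatingWord_succ, cs.wordProd_concat, ← mul_assoc, ← hwv,
      cs.simple_mul_simple_cancel_right]
  · exact ⟨w, 0, by simp [CoxeterSystem.alternatingWord], hn, hs, ht⟩

theorem succ_le_of_not_isRightDescent_mul_alternatingWord {v : W} {s t : B} {k : ℕ}
    (hlen : cs.length v + k =
      cs.length (v * cs.wordProd (CoxeterSystem.alternatingWord s t k)))
    (hs : ¬ cs.IsRightDescent (v * cs.wordProd (CoxeterSystem.alternatingWord s t k)) s)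
    (hst : M s t ≠ 0) : k + 1 ≤ M s t := by
  by_contra! hlt
  have hred := cs.not_isReduced_alternatingWord t s (m := k + 1)
    (by rwa [M.symmetric]) (by rwa [M.symmetric])
  rw [CoxeterSystem.IsReduced, CoxeterSystem.length_alternatingWord] at hred
  have hle := cs.length_wordProd_le (CoxeterSystem.alternatingWord t s (k + 1))
  rw [CoxeterSystem.length_alternatingWord] at hle
  have hmul := cs.length_mul_le v (cs.wordProd (CoxeterSystem.alternatingWord t s (k + 1)))
  rw [CoxeterSystem.alternatingWord_succ, cs.wordProd_concat, ← mul_assoc,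
    cs.not_isRightDescent_iff.1 hs, ← cs.wordProd_concat,
    ← CoxeterSystem.alternatingWord_succ] at hmul
  omega

theorem geometricRep_mul_apply (w w' : W) (v : B →₀ ℝ) :
    geometricRep cs (w * w') v = geometricRep cs w (geometricRep cs w' v) := by
  rw [map_mul, LinearEquiv.mul_apply]

theorem geometricRep_mul_simple_apply (w : W) (s : B) (v : B →₀ ℝ) :
    geometricRep cs (w * cs.simple s) v = geometricRep cs w (simpleReflection M s v) := by
  rw [geometricRep_mul_apply, geometricRep_simple]

theorem geometricRep_simple_mul_apply (s : B) (w : W) (v : B →₀ ℝ) :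
    geometricRep cs (cs.simple s * w) v = simpleReflection M s (geometricRep cs w v) := by
  rw [geometricRep_mul_apply, geometricRep_simple]

open Polynomial in
theorem geometricRep_alternatingWord (s t : B) (k : ℕ) :
    geometricRep cs (cs.wordProd (CoxeterSystem.alternatingWord s t k)) (simpleRoot s) =
      (Chebyshev.U ℝ k).eval (Real.cos (Real.pi / M s t)) • simpleRoot (if Even k then s else t) +
      (Chebyshev.U ℝ (k - 1)).eval (Real.cos (Real.pi / M s t)) •
        simpleRoot (if Even k then t else s) := by
  induction k with
  | zero => simp [CoxeterSystem.alternatingWord]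
  | succ k ih =>
    rw [CoxeterSystem.alternatingWord_succ', cs.wordProd_cons, geometricRep_simple_mul_apply, ih,
      map_add, map_smul, map_smul, simpleReflection_simpleRoot_self, simpleReflection_apply,
      Nat.cast_succ, add_sub_cancel_right, Chebyshev.U_add_one]
    by_cases hk : Even k
    · have hk' : ¬ Even (k + 1) := by simp [hk, parity_simps]
      simp only [hk, hk', if_true, if_false, form_simpleRoot, eval_sub, eval_mul, eval_ofNat,
        eval_X]
      module
    · have hk' : Even (k + 1) := by simp [hk, parity_simps]
      simp only [hk, hk', if_true, if_false, form_simpleRoot, M.symmetric t s, eval_sub, eval_mul,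
        eval_ofNat, eval_X]
      module

theorem geometricRep_simpleRoot_nonneg {w : W} {s : B} (hs : ¬ cs.IsRightDescent w s) :
    0 ≤ geometricRep cs w (simpleRoot s) := by
  induction hn : cs.length w using Nat.strong_induction_on generalizing w s with
  | _ n ih =>
  by_cases hw : w = 1
  · subst hw
    rw [map_one]
    exact Finsupp.single_nonneg.2 zero_le_one
  obtain ⟨t, ht⟩ := cs.exists_rightDescent_of_ne_one hw
  have hst : s ≠ t := fun hst => hs (hst ▸ ht)
  obtain ⟨v, k, rfl, hlen, hvs, hvt⟩ := exists_eq_mul_alternatingWord cs hs t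
  have hk : k ≠ 0 := by
    rintro rfl
    exact hvt (by simpa [CoxeterSystem.alternatingWord] using ht)
  have hbound (h₀ : M s t ≠ 0) : (k : ℤ) + 1 ≤ M s t := by
    exact_mod_cast succ_le_of_not_isRightDescent_mul_alternatingWord cs hlen hs h₀
  have hnonneg (r : B) (hr : r = s ∨ r = t) : 0 ≤ geometricRep cs v (simpleRoot r) :=
    ih _ (by omega) (by rcases hr with rfl | rfl <;> assumption) rfl
  have hM := M.off_diagonal s t hst
  rw [geometricRep_mul_apply, geometricRep_alternatingWord, map_add, map_smul, map_smul]
  refine add_nonneg (smul_nonneg ?_ (hnonneg _ ?_)) (smul_nonneg ?_ (hnonneg _ ?_))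
  · exact chebyshevU_eval_cos_pi_div_nonneg hM (by omega) hbound
  · exact ite_eq_or_eq _ _ _
  · exact chebyshevU_eval_cos_pi_div_nonneg hM (by omega) fun h₀ => by linarith [hbound h₀]
  · exact (ite_eq_or_eq _ _ _).symm

end Dihedral

section Roots

variable {B : Type*} {M : CoxeterMatrix B} {W : Type*} [Group W] {cs : CoxeterSystem M W}
  {v : B →₀ ℝ} {K : Set B} {s : B}

theorem geometricRep_inv_apply_self (w : W) (v : B →₀ ℝ) :
    geometricRep cs w⁻¹ (geometricRep cs w v) = v := by
  rw [← geometricRep_mul_apply, inv_mul_cancel, map_one, LinearEquiv.coe_one, id]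

theorem geometricRep_apply_inv_self (w : W) (v : B →₀ ℝ) :
    geometricRep cs w (geometricRep cs w⁻¹ v) = v := by
  rw [← geometricRep_mul_apply, mul_inv_cancel, map_one, LinearEquiv.coe_one, id]

theorem form_geometricRep (w : W) (u v : B →₀ ℝ) :
    form M (geometricRep cs w u) (geometricRep cs w v) = form M u v := by
  induction w using cs.simple_induction_left with
  | one => rw [map_one, LinearEquiv.coe_one, id, id]
  | mul_simple_left w s ih =>
    rw [geometricRep_simple_mul_apply, geometricRep_simple_mul_apply, form_simpleReflection, ih]

theorem simpleRoot_mem_posRoots (s : B) : simpleRoot s ∈ posRoots cs :=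
  ⟨⟨1, s, by rw [map_one, LinearEquiv.coe_one, id]⟩,
    fun r => Finsupp.single_nonneg.2 zero_le_one r⟩

theorem geometricRep_mem_roots (hv : v ∈ roots cs) (w : W) : geometricRep cs w v ∈ roots cs := by
  obtain ⟨u, s, rfl⟩ := hv
  exact ⟨w * u, s, (geometricRep_mul_apply cs w u _).symm⟩

theorem simpleReflection_mem_roots (hv : v ∈ roots cs) (s : B) :
    simpleReflection M s v ∈ roots cs :=
  geometricRep_simple cs s ▸ geometricRep_mem_roots hv (cs.simple s)

theorem neg_mem_roots (hv : v ∈ roots cs) : -v ∈ roots cs := by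
  obtain ⟨u, s, rfl⟩ := hv
  refine ⟨u * cs.simple s, s, ?_⟩
  rw [geometricRep_mul_simple_apply, simpleReflection_simpleRoot_self, map_neg]

theorem form_self_of_mem_roots (hv : v ∈ roots cs) : form M v v = 1 := by
  obtain ⟨u, s, rfl⟩ := hv
  rw [form_geometricRep, form_simpleRoot_self]

theorem ne_zero_of_mem_roots (hv : v ∈ roots cs) : v ≠ 0 := by
  rintro rfl
  simpa using form_self_of_mem_roots hv

theorem zero_notMem_posRoots : (0 : B →₀ ℝ) ∉ posRoots cs :=
  fun h => ne_zero_of_mem_roots h.1 rfl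

theorem mem_posRoots_or_neg_mem_posRoots (hv : v ∈ roots cs) :
    v ∈ posRoots cs ∨ -v ∈ posRoots cs := by
  obtain ⟨w, s, rfl⟩ := id hv
  by_cases hs : cs.IsRightDescent w s
  · have hnonneg := geometricRep_simpleRoot_nonneg cs
      (cs.isRightDescent_iff_not_isRightDescent_mul.1 hs)
    rw [geometricRep_mul_simple_apply, simpleReflection_simpleRoot_self, map_neg] at hnonneg
    exact Or.inr ⟨neg_mem_roots hv, hnonneg⟩
  · exact Or.inl ⟨hv, geometricRep_simpleRoot_nonneg cs hs⟩

theorem exists_ne_pos_of_mem_posRoots (hv : v ∈ posRoots cs) (hs : v ≠ simpleRoot s) :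
    ∃ r, r ≠ s ∧ 0 < v r := by
  by_contra! h
  have hvs : v = v s • simpleRoot s := by
    ext r
    rcases eq_or_ne r s with rfl | hr
    · simp [simpleRoot]
    · simp [simpleRoot, hr.symm, (h r hr).antisymm (hv.2 r)]
  have hform := form_self_of_mem_roots hv.1
  rw [hvs] at hform
  simp only [map_smul, LinearMap.smul_apply, form_simpleRoot_self, smul_eq_mul, mul_one] at hform
  have hone : v s = 1 := by nlinarith [hv.2 s]
  rw [hone, one_smul] at hvs
  exact hs hvs

theorem simpleReflection_mem_posRoots (hv : v ∈ posRoots cs) (hs : v ≠ simpleRoot s) :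
    simpleReflection M s v ∈ posRoots cs := by
  obtain ⟨r, hrs, hr⟩ := exists_ne_pos_of_mem_posRoots hv hs
  refine (mem_posRoots_or_neg_mem_posRoots (simpleReflection_mem_roots hv.1 s)).resolve_right
    fun h => ?_
  have := h.2 r
  rw [Finsupp.neg_apply, simpleReflection_apply_of_ne M hrs] at this
  linarith

theorem map_nonneg_of_forall_simpleRoot {f : Module.Dual ℝ (B →₀ ℝ)} (hv : 0 ≤ v)
    (hf : ∀ s, v s ≠ 0 → 0 ≤ f (simpleRoot s)) : 0 ≤ f v := by
  rw [map_eq_sum_simpleRoot f v]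
  exact Finset.sum_nonneg fun s hs => mul_nonneg (hv s) (hf s (Finsupp.mem_support_iff.1 hs))

theorem mem_standardFlat_iff :
    v ∈ standardFlat cs K ↔ v ∈ posRoots cs ∧ v ∈ Finsupp.supported ℝ ℝ K := by
  rw [← span_image_simpleRoot]
  rfl

theorem simpleRoot_mem_standardFlat_iff : simpleRoot s ∈ standardFlat cs K ↔ s ∈ K := by
  rw [mem_standardFlat_iff, simpleRoot_mem_supported_iff,
    and_iff_right (simpleRoot_mem_posRoots s)]

theorem standardFlat_univ : standardFlat cs univ = posRoots cs := by
  ext v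
  rw [mem_standardFlat_iff, Finsupp.supported_univ, and_iff_left Submodule.mem_top]

theorem simpleReflection_mem_standardFlat (hs : s ∈ K) (hv : v ∈ standardFlat cs K)
    (hne : v ≠ simpleRoot s) : simpleReflection M s v ∈ standardFlat cs K := by
  rw [mem_standardFlat_iff] at hv ⊢
  exact ⟨simpleReflection_mem_posRoots hv.1 hne, simpleReflection_mem_supported hs hv.2⟩

theorem standardFlat_induction {P : (B →₀ ℝ) → Prop} (simple : ∀ s ∈ K, P (simpleRoot s))
    (reflection : ∀ s ∈ K, ∀ v, P v → P (simpleReflection M s v))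
    (hv : v ∈ standardFlat cs K) : P v := by
  -- Any `w` making `v` negative has a right descent in `K`, and `w * s` makes `s v` negative.
  have of_not_nonneg (w : W) (v) (hv : v ∈ standardFlat cs K) (hw : ¬ 0 ≤ geometricRep cs w v) :
      P v := by
    induction hn : cs.length w using Nat.strong_induction_on generalizing w v with
    | _ n ih =>
    obtain ⟨s, hs, hws⟩ : ∃ s ∈ K, ¬ 0 ≤ geometricRep cs w (simpleRoot s) := by
      by_contra! h
      refine hw fun r => map_nonneg_of_forall_simpleRoot
        (f := Finsupp.lapply r ∘ₗ (geometricRep cs w).toLinearMap) hv.1.2 fun s hs => h s ?_ r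
      exact (mem_standardFlat_iff.1 hv).2 (Finsupp.mem_support_iff.2 hs)
    have hlen := cs.isRightDescent_iff.1 (not_imp_comm.1 (geometricRep_simpleRoot_nonneg cs) hws)
    rcases eq_or_ne v (simpleRoot s) with rfl | hne
    · exact simple s hs
    · have hrefl := ih _ (by omega) (w * cs.simple s) _
        (simpleReflection_mem_standardFlat hs hv hne)
        (by rwa [geometricRep_mul_simple_apply, simpleReflection_simpleReflection]) rfl
      simpa only [simpleReflection_simpleReflection] using reflection s hs _ hrefl
  obtain ⟨u, t, hvu⟩ := hv.1.1
  refine of_not_nonneg (cs.simple t * u⁻¹) v hv fun hnonneg => ?_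
  rw [geometricRep_simple_mul_apply, hvu, geometricRep_inv_apply_self,
    simpleReflection_simpleRoot_self] at hnonneg
  have := hnonneg t
  norm_num [simpleRoot] at this

theorem standardFlat_union_subset {K' : Set B} (hd : Disjoint K K')
    (hadj : ∀ s ∈ K, ∀ t ∈ K', ¬ (diagram M).Adj s t) :
    standardFlat cs (K ∪ K') ⊆
      (Finsupp.supported ℝ ℝ K : Set (B →₀ ℝ)) ∪ Finsupp.supported ℝ ℝ K' := by
  have simpleReflection_eq_self {s : B} {L : Set B} (hsL : ∀ t ∈ L, s ≠ t ∧ ¬ (diagram M).Adj s t)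
      {v : B →₀ ℝ} (hv : v ∈ Finsupp.supported ℝ ℝ L) : simpleReflection M s v = v := by
    have hle : Finsupp.supported ℝ ℝ L ≤ LinearMap.ker (form M (simpleRoot s)) :=
      supported_le_iff.2 fun t ht => form_simpleRoot_eq_zero M (hsL t ht).1 (hsL t ht).2
    rw [simpleReflection_apply, form_comm, LinearMap.mem_ker.1 (hle hv)]
    module
  refine fun v hv => standardFlat_induction ?_ ?_ hv
  · exact fun s hs => hs.imp simpleRoot_mem_supported_iff.2 simpleRoot_mem_supported_iff.2
  · rintro s (hs | hs) v (hv | hv)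
    · exact Or.inl (simpleReflection_mem_supported hs hv)
    · rw [simpleReflection_eq_self (fun t ht => ⟨hd.ne_of_mem hs ht, hadj s hs t ht⟩) hv]
      exact Or.inr hv
    · rw [simpleReflection_eq_self (fun t ht => ⟨(hd.ne_of_mem ht hs).symm,
        fun h => hadj t ht s hs h.symm⟩) hv]
      exact Or.inl hv
    · exact Or.inr (simpleReflection_mem_supported hs hv)

theorem form_simpleRoot_neg_of_mem_posRoots (hv : v ∈ posRoots cs) (hs : v s = 0) {t : B}
    (ht : v t ≠ 0) (hst : (diagram M).Adj t s) : form M v (simpleRoot s) < 0 := by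
  rw [← LinearMap.flip_apply, map_eq_sum_simpleRoot]
  refine Finset.sum_neg' (fun r hr => ?_) ⟨t, Finsupp.mem_support_iff.2 ht, ?_⟩
  · refine mul_nonpos_of_nonneg_of_nonpos (hv.2 r) (form_simpleRoot_nonpos M ?_)
    rintro rfl
    exact Finsupp.mem_support_iff.1 hr hs
  · exact mul_neg_of_pos_of_neg (lt_of_le_of_ne (hv.2 t) ht.symm) (form_simpleRoot_neg M hst)

theorem exists_mem_posRoots_support_eq_insert (hv : v ∈ posRoots cs) (hs : v s = 0) {t : B}
    (ht : v t ≠ 0) (hst : (diagram M).Adj t s) :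
    ∃ u ∈ posRoots cs, (u.support : Set B) = insert s ↑v.support := by
  have hne : v ≠ simpleRoot s := by
    rintro rfl
    simp [simpleRoot] at hs
  refine ⟨_, simpleReflection_mem_posRoots hv hne, ?_⟩
  ext r
  rcases eq_or_ne r s with rfl | hr
  · have hval : simpleReflection M r v r = -(2 * form M v (simpleRoot r)) := by
      simp [simpleReflection_apply, simpleRoot, hs]
    simp [hval, (form_simpleRoot_neg_of_mem_posRoots hv hs ht hst).ne]
  · simp only [Finset.mem_coe, Finsupp.mem_support_iff, simpleReflection_apply_of_ne M hr,
      mem_insert_iff, hr, false_or]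

theorem exists_mem_posRoots_support_eq (hfin : K.Finite)
    (hK : ((diagram M).induce K).Connected) :
    ∃ v ∈ posRoots cs, (v.support : Set B) = K := by
  obtain ⟨s, hs⟩ := hK.nonempty
  obtain ⟨L, ⟨⟨v, hv, rfl⟩, hvK⟩, hmax⟩ := Set.Finite.exists_maximal
    (s := {L : Set B | (∃ v ∈ posRoots cs, (v.support : Set B) = L) ∧ L ⊆ K})
    (hfin.finite_subsets.subset fun _ hL => hL.2)
    ⟨{s}, ⟨simpleRoot s, simpleRoot_mem_posRoots s, by simp [simpleRoot]⟩,
      singleton_subset_iff.2 hs⟩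
  refine ⟨v, hv, hvK.antisymm fun s hs => by_contra fun hvs => ?_⟩
  obtain ⟨t, ht⟩ := Finsupp.support_nonempty_iff.2 (ne_zero_of_mem_roots hv.1)
  obtain ⟨p⟩ := hK.preconnected ⟨t, hvK ht⟩ ⟨s, hs⟩
  obtain ⟨d, -, hd₁, hd₂⟩ :=
    p.exists_boundary_dart (Subtype.val ⁻¹' (v.support : Set B)) ht hvs
  refine hd₂ (hmax ⟨exists_mem_posRoots_support_eq_insert hv (Finsupp.notMem_support_iff.1 hd₂)
    (Finsupp.mem_support_iff.1 hd₁) d.adj, insert_subset d.snd.2 hvK⟩ (subset_insert _ _)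
    (mem_insert _ _))

end Roots

/-! ### Standard flats -/

section StandardFlats

variable {B : Type*} {M : CoxeterMatrix B} {W : Type*} [Group W] {cs : CoxeterSystem M W}
  {J K : Set B}

theorem span_standardFlat (J : Set B) :
    Submodule.span ℝ (standardFlat cs J) = Finsupp.supported ℝ ℝ J :=
  le_antisymm (Submodule.span_le.2 fun _ hv => (mem_standardFlat_iff.1 hv).2) <|
    supported_le_iff.2 fun _ hs => Submodule.subset_span (simpleRoot_mem_standardFlat_iff.2 hs)

theorem standardFlat_subset_posRoots (J : Set B) : standardFlat cs J ⊆ posRoots cs :=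
  sep_subset _ _

theorem isFlat_standardFlat (J : Set B) : (rootMatroid cs).IsFlat (standardFlat cs J) := by
  refine isFlat_vectorMatroid_iff.2 ⟨standardFlat_subset_posRoots J, fun v hv h => ?_⟩
  rw [span_standardFlat] at h
  exact mem_standardFlat_iff.2 ⟨hv, h⟩

theorem standardFlat_injective : Function.Injective (standardFlat cs) := fun J K h => by
  ext s
  rw [← simpleRoot_mem_standardFlat_iff (cs := cs), h, simpleRoot_mem_standardFlat_iff]

theorem standardFlat_nonempty_iff : (standardFlat cs K).Nonempty ↔ K.Nonempty := by
  refine ⟨fun ⟨v, hv⟩ => ?_, fun ⟨s, hs⟩ => ⟨_, simpleRoot_mem_standardFlat_iff.2 hs⟩⟩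
  have hsupp := Finsupp.support_nonempty_iff.2 (ne_zero_of_mem_roots hv.1.1)
  exact (Finset.coe_nonempty.2 hsupp).mono (mem_standardFlat_iff.1 hv).2

theorem isIndecomposableMod_standardFlat (hfin : K.Finite)
    (hK : ((diagram M).induce K).Connected) (J : Set B) :
    IsIndecomposableMod (Finsupp.supported ℝ ℝ J) (standardFlat cs K) := by
  obtain ⟨v, hv, rfl⟩ := exists_mem_posRoots_support_eq (cs := cs) hfin hK
  refine (isIndecomposableMod_insert_simpleRoot v J).superset (insert_subset ?_ ?_) fun u hu => ?_
  · exact mem_standardFlat_iff.2 ⟨hv, Finsupp.mem_supported_support ℝ v⟩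
  · exact image_subset_iff.2 fun s hs => simpleRoot_mem_standardFlat_iff.2 hs
  · refine Submodule.span_mono (subset_insert _ _) ?_
    rw [span_image_simpleRoot]
    exact (mem_standardFlat_iff.1 hu).2

theorem connected_of_isIndecomposableMod_standardFlat (hK : K.Nonempty)
    (h : IsIndecomposableMod (⊥ : Submodule ℝ (B →₀ ℝ)) (standardFlat cs K)) :
    ((diagram M).induce K).Connected := by
  obtain ⟨s, hs⟩ := hK
  rw [SimpleGraph.connected_iff_exists_forall_reachable]
  set A : Set B := Subtype.val '' {t : K | ((diagram M).induce K).Reachable ⟨s, hs⟩ t}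
  have hAK : A ⊆ K := by
    rintro _ ⟨t, -, rfl⟩
    exact t.2
  have hadj : ∀ t ∈ A, ∀ r ∈ K \ A, ¬ (diagram M).Adj t r := by
    rintro _ ⟨t, ht, rfl⟩ r ⟨hr, hrA⟩ htr
    exact hrA ⟨⟨r, hr⟩, ht.trans (SimpleGraph.Adj.reachable htr), rfl⟩
  have hdisj : Disjoint A (K \ A) := disjoint_sdiff_right
  have hcover := standardFlat_union_subset (cs := cs) hdisj hadj
  rw [union_sdiff_cancel hAK] at hcover
  have subset_of_standardFlat_subset (L : Set B)
      (hL : standardFlat cs K ⊆ Finsupp.supported ℝ ℝ L) : K ⊆ L := fun t ht =>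
    simpleRoot_mem_supported_iff.1 (hL (simpleRoot_mem_standardFlat_iff.2 ht))
  have hKA : K ⊆ A := by
    refine (h (Finsupp.disjoint_supported_supported hdisj).eq_bot hcover).elim
      (subset_of_standardFlat_subset _) fun hsub => ?_
    exact absurd ⟨⟨s, hs⟩, .refl _, rfl⟩ (subset_of_standardFlat_subset _ hsub hs).2
  refine ⟨⟨s, hs⟩, fun t => ?_⟩
  obtain ⟨t', ht', htt'⟩ := hKA t.2
  exact Subtype.ext htt' ▸ ht'

theorem isConnectedFlat_iff {G : Set (B →₀ ℝ)} (hG : G ⊆ posRoots cs) :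
    IsConnectedFlat cs G ↔ G.Nonempty ∧ IsIndecomposableMod (⊥ : Submodule ℝ (B →₀ ℝ)) G :=
  matroidConnected_restrict_vectorMatroid_iff (fun h => zero_notMem_posRoots (hG h)) hG

theorem isConnectedFlat_standardFlat_iff (hfin : K.Finite) :
    IsConnectedFlat cs (standardFlat cs K) ↔ ((diagram M).induce K).Connected := by
  rw [isConnectedFlat_iff (standardFlat_subset_posRoots K), standardFlat_nonempty_iff]
  refine ⟨fun h => connected_of_isIndecomposableMod_standardFlat h.1 h.2, fun h =>
    ⟨nonempty_coe_sort.1 h.nonempty, ?_⟩⟩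
  simpa using isIndecomposableMod_standardFlat (cs := cs) hfin h ∅

end StandardFlats

section Dominant

variable {B : Type*} {M : CoxeterMatrix B} {W : Type*} [Group W] {cs : CoxeterSystem M W}
  {f : Module.Dual ℝ (B →₀ ℝ)} {v : B →₀ ℝ} {J : Set B}

/-- A functional is dominant if it lies in the closed fundamental chamber `R` of the dual space,
that is, if it is nonnegative on the simple roots. -/
def IsDominant (f : Module.Dual ℝ (B →₀ ℝ)) : Prop := ∀ s, 0 ≤ f (simpleRoot s)

theorem IsDominant.map_nonneg (hf : IsDominant f) (hv : v ∈ posRoots cs) : 0 ≤ f v :=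
  map_nonneg_of_forall_simpleRoot hv.2 fun s _ => hf s

theorem IsDominant.sep_posRoots_eq_standardFlat (hf : IsDominant f) :
    {v ∈ posRoots cs | f v = 0} = standardFlat cs {s | f (simpleRoot s) = 0} := by
  ext v
  rw [mem_standardFlat_iff]
  refine and_congr_right fun hv => ⟨fun h s hs => ?_, fun h => ?_⟩
  · rw [map_eq_sum_simpleRoot, Finsupp.sum,
      Finset.sum_eq_zero_iff_of_nonneg fun s _ => mul_nonneg (hv.2 s) (hf s)] at h
    exact (mul_eq_zero.1 (h s hs)).resolve_left (Finsupp.mem_support_iff.1 hs)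
  · exact supported_le_iff (U := LinearMap.ker f).2 (fun _ hs => hs) h

theorem exists_isDominant_setOf_eq_zero_eq (J : Set B) :
    ∃ f, IsDominant f ∧ {s | f (simpleRoot s) = 0} = J := by
  classical
  refine ⟨Finsupp.linearCombination ℝ (Jᶜ.indicator 1), fun s => ?_, ?_⟩
  · rw [simpleRoot, Finsupp.linearCombination_single, one_smul]
    exact indicator_nonneg (fun _ _ => zero_le_one) s
  · ext s
    simp [simpleRoot]

theorem isPositiveFlat_iff_exists_isDominant {F : Set (B →₀ ℝ)} :
    IsPositiveFlat cs F ↔ ∃ f, IsDominant f ∧ {v ∈ posRoots cs | f v = 0} = F := by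
  have image_val_eq (f : Module.Dual ℝ (B →₀ ℝ)) :
      Subtype.val '' {a : posRoots cs | SignType.sign (f a) = 0} =
        {v ∈ posRoots cs | f v = 0} := by
    ext v
    simp [and_comm]
  constructor
  · rintro ⟨-, _, ⟨f, rfl⟩, hf, rfl⟩
    refine ⟨f, fun s => ?_, (image_val_eq f).symm⟩
    have hs := hf ⟨simpleRoot s, simpleRoot_mem_posRoots s⟩
    exact hs.elim (fun h => (sign_eq_one_iff.1 h).le) fun h => (sign_eq_zero_iff.1 h).ge
  · rintro ⟨f, hf, rfl⟩
    refine ⟨?_, _, ⟨f, rfl⟩, fun a => ?_, (image_val_eq f).symm⟩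
    · rw [hf.sep_posRoots_eq_standardFlat]
      exact isFlat_standardFlat _
    · exact (hf.map_nonneg a.2).eq_or_lt'.symm.imp sign_eq_one_iff.2 sign_eq_zero_iff.2

theorem isPositiveFlat_iff {F : Set (B →₀ ℝ)} :
    IsPositiveFlat cs F ↔ ∃ J, standardFlat cs J = F := by
  rw [isPositiveFlat_iff_exists_isDominant]
  constructor
  · rintro ⟨f, hf, rfl⟩
    exact ⟨_, hf.sep_posRoots_eq_standardFlat.symm⟩
  · rintro ⟨J, rfl⟩
    obtain ⟨f, hf, rfl⟩ := exists_isDominant_setOf_eq_zero_eq J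
    exact ⟨f, hf, hf.sep_posRoots_eq_standardFlat⟩

theorem IsDominant.mem_titsCone (hf : IsDominant f) : f ∈ titsCone cs :=
  ⟨1, f, hf, fun v => by rw [inv_one, map_one, LinearEquiv.coe_one, id]⟩

theorem isParabolicFlat_standardFlat [Finite B] (J : Set B) :
    IsParabolicFlat cs (standardFlat cs J) := by
  refine ⟨isFlat_standardFlat J, le_antisymm (Submodule.span_le.2 inter_subset_left) fun f hf => ?_⟩
  have := Fintype.ofFinite B
  have hsum : f = ∑ s, f (simpleRoot s) • Finsupp.lapply s := by
    ext s
    classical simp [simpleRoot, Finsupp.single_apply]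
  rw [flatSpace, span_standardFlat, Submodule.mem_dualAnnihilator] at hf
  rw [hsum, flatSpace, span_standardFlat]
  refine Submodule.sum_mem _ fun s _ => ?_
  by_cases hs : s ∈ J
  · rw [hf _ (simpleRoot_mem_supported_iff.2 hs), zero_smul]
    exact Submodule.zero_mem _
  · refine Submodule.smul_mem _ _ (Submodule.subset_span ⟨?_, IsDominant.mem_titsCone ?_⟩)
    · exact (Submodule.mem_dualAnnihilator _).2 fun v hv => (Finsupp.mem_supported' ℝ v).1 hv s hs
    · exact fun r => (simpleRoot_mem_posRoots (cs := cs) r).2 s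

end Dominant

section CircuitousBase

variable {B : Type*} {M : CoxeterMatrix B} {W : Type*} [Group W] {cs : CoxeterSystem M W}

theorem closure_image_simpleRoot (J : Set B) :
    (rootMatroid cs).closure (simpleRoot '' J) = standardFlat cs J := by
  ext v
  refine mem_closure_vectorMatroid_iff ?_
  rintro _ ⟨s, -, rfl⟩
  exact simpleRoot_mem_posRoots s

theorem isBase_range_simpleRoot : (rootMatroid cs).IsBase (range simpleRoot) := by
  have hindep : (rootMatroid cs).Indep (range simpleRoot) :=
    (isRepresentedBy_vectorMatroid _).2 ⟨range_subset_iff.2 simpleRoot_mem_posRoots,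
      (Finsupp.linearIndependent_single_one ℝ B).linearIndepOn_id⟩
  refine hindep.isBase_of_ground_subset_closure ?_
  rw [← image_univ, closure_image_simpleRoot, standardFlat_univ]
  exact subset_rfl

theorem simpleRoot_injective : Function.Injective (simpleRoot : B → B →₀ ℝ) :=
  Finsupp.single_left_injective one_ne_zero

theorem fundCircuit_range_simpleRoot_sdiff_singleton {v : B →₀ ℝ} (hv : v ∈ posRoots cs)
    (hvΔ : v ∉ range simpleRoot) :
    (rootMatroid cs).fundCircuit v (range simpleRoot) \ {v} = simpleRoot '' v.support := by
  have hbase := isBase_range_simpleRoot (cs := cs)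
  have simpleRoot_mem_iff (s : B) :
      simpleRoot s ∈ (rootMatroid cs).fundCircuit v (range simpleRoot) ↔ s ∈ v.support := by
    have hsv : v ∉ ({simpleRoot s} : Set (B →₀ ℝ)) := fun h => hvΔ (h ▸ mem_range_self s)
    have himage : range simpleRoot \ {simpleRoot s} = simpleRoot '' {s}ᶜ := by
      rw [image_compl_eq_range_sdiff_image simpleRoot_injective, image_singleton]
    rw [hbase.indep.mem_fundCircuit_iff (hbase.closure_eq ▸ hv) hvΔ, insert_sdiff_of_notMem _ hsv,
      ← (hbase.indep.subset sdiff_subset).notMem_closure_iff_of_notMem (fun h => hvΔ h.1) hv,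
      himage, closure_image_simpleRoot, mem_standardFlat_iff, and_iff_right hv,
      Finsupp.mem_supported']
    simp
  ext e
  constructor
  · rintro ⟨he, hev⟩
    obtain ⟨s, rfl⟩ := (Matroid.fundCircuit_subset_insert _ _ _ he).resolve_left hev
    exact mem_image_of_mem _ ((simpleRoot_mem_iff s).1 he)
  · rintro ⟨s, hs, rfl⟩
    exact ⟨(simpleRoot_mem_iff s).2 hs, fun h => hvΔ (h ▸ mem_range_self s)⟩

theorem closure_fundCircuit_range_simpleRoot {v : B →₀ ℝ} (hv : v ∈ posRoots cs)
    (hvΔ : v ∉ range simpleRoot) :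
    (rootMatroid cs).closure ((rootMatroid cs).fundCircuit v (range simpleRoot)) =
      standardFlat cs v.support := by
  rw [← (isBase_range_simpleRoot.fundCircuit_isCircuit hv hvΔ).closure_sdiff_singleton_eq v,
    fundCircuit_range_simpleRoot_sdiff_singleton hv hvΔ, closure_image_simpleRoot]

theorem isCircuitousBase_range_simpleRoot [Finite B] :
    IsCircuitousBase (rootMatroid cs) (range simpleRoot) := by
  refine ⟨isBase_range_simpleRoot, fun I hI hnontrivial hconn => ?_⟩
  obtain ⟨J, rfl⟩ := subset_range_iff_exists_image_eq.1 hI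
  rw [closure_image_simpleRoot] at hconn ⊢
  obtain ⟨v, hv, rfl⟩ := exists_mem_posRoots_support_eq (cs := cs) (toFinite J)
    ((isConnectedFlat_standardFlat_iff (toFinite J)).1 hconn)
  have hvΔ : v ∉ range simpleRoot := by
    rintro ⟨s, rfl⟩
    simp [simpleRoot] at hnontrivial
  exact ⟨v, ⟨hv, hvΔ⟩, closure_fundCircuit_range_simpleRoot hv hvΔ⟩

end CircuitousBase

/-! ### The Tits cone and parabolic flats -/

section TitsCone

variable {B : Type*} {M : CoxeterMatrix B} {W : Type*} [Group W] {cs : CoxeterSystem M W}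
  {f g : Module.Dual ℝ (B →₀ ℝ)} {v : B →₀ ℝ}

theorem mem_titsCone_iff_exists_isDominant_comp :
    f ∈ titsCone cs ↔ ∃ w, IsDominant (f ∘ₗ (geometricRep cs w).toLinearMap) := by
  constructor
  · rintro ⟨w, g, hg, hfg⟩
    refine ⟨w, fun s => ?_⟩
    simpa only [LinearMap.comp_apply, LinearEquiv.coe_coe, hfg, geometricRep_inv_apply_self] using
      hg s
  · rintro ⟨w, hw⟩
    exact ⟨w, _, hw, fun v => congrArg f (geometricRep_apply_inv_self w v).symm⟩

variable (cs) in
/-- The inversions of a functional are the positive roots on which it is negative. If `f` is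
positive on the simple roots, the inversions of `f ∘ w` are those of the group element `w`. -/
def inversions (f : Module.Dual ℝ (B →₀ ℝ)) : Set (B →₀ ℝ) := {v ∈ posRoots cs | f v < 0}

theorem inversions_comp_simpleReflection_sdiff (s : B) :
    inversions cs (f ∘ₗ (simpleReflection M s).toLinearMap) \ {simpleRoot s} =
      simpleReflection M s '' (inversions cs f \ {simpleRoot s}) := by
  have mem_sdiff {f g : Module.Dual ℝ (B →₀ ℝ)} (hfg : ∀ v, g (simpleReflection M s v) = f v)
      {v : B →₀ ℝ} (hv : v ∈ inversions cs f \ {simpleRoot s}) :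
      simpleReflection M s v ∈ inversions cs g \ {simpleRoot s} := by
    refine ⟨⟨simpleReflection_mem_posRoots hv.1.1 hv.2, (hfg v).trans_lt hv.1.2⟩, fun h => ?_⟩
    have hneg := congrArg (simpleReflection M s) (mem_singleton_iff.1 h)
    rw [simpleReflection_simpleReflection, simpleReflection_simpleRoot_self] at hneg
    have hs := hv.1.1.2 s
    rw [hneg] at hs
    norm_num [simpleRoot] at hs
  refine Subset.antisymm (fun v hv => ⟨simpleReflection M s v, mem_sdiff (fun _ => rfl) hv,
    simpleReflection_simpleReflection M s v⟩) (image_subset_iff.2 fun v hv => mem_sdiff ?_ hv)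
  exact fun v => congrArg f (simpleReflection_simpleReflection M s v)

theorem finite_inversions_comp_simpleReflection (hf : (inversions cs f).Finite) (s : B) :
    (inversions cs (f ∘ₗ (simpleReflection M s).toLinearMap)).Finite := by
  refine .of_sdiff ?_ (finite_singleton (simpleRoot s))
  rw [inversions_comp_simpleReflection_sdiff]
  exact hf.sdiff.image _

theorem ncard_inversions_comp_simpleReflection_lt (hf : (inversions cs f).Finite) {s : B}
    (hs : f (simpleRoot s) < 0) :
    (inversions cs (f ∘ₗ (simpleReflection M s).toLinearMap)).ncard <
      (inversions cs f).ncard := by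
  have hnotMem : simpleRoot s ∉ inversions cs (f ∘ₗ (simpleReflection M s).toLinearMap) := by
    rintro ⟨-, h⟩
    simp only [LinearMap.comp_apply, LinearEquiv.coe_coe, simpleReflection_simpleRoot_self,
      map_neg] at h
    linarith
  rw [← sdiff_singleton_eq_self hnotMem, inversions_comp_simpleReflection_sdiff,
    ncard_image_of_injective _ (simpleReflection M s).injective]
  exact ncard_sdiff_singleton_lt_of_mem ⟨simpleRoot_mem_posRoots s, hs⟩ hf

theorem finite_inversions_comp_geometricRep (hf : (inversions cs f).Finite) (w : W) :
    (inversions cs (f ∘ₗ (geometricRep cs w).toLinearMap)).Finite := by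
  induction w using cs.simple_induction_right with
  | one => rwa [map_one]
  | mul_simple_right w s ih =>
    rw [map_mul, geometricRep_simple]
    exact finite_inversions_comp_simpleReflection ih s

theorem exists_isDominant_comp_of_finite_inversions (hf : (inversions cs f).Finite) :
    ∃ w, IsDominant (f ∘ₗ (geometricRep cs w).toLinearMap) := by
  induction hn : (inversions cs f).ncard using Nat.strong_induction_on generalizing f with
  | _ n ih =>
  by_cases hdom : IsDominant f
  · exact ⟨1, by rwa [map_one]⟩
  · obtain ⟨s, hs⟩ := not_forall.1 hdom
    obtain ⟨w, hw⟩ := ih _ (hn ▸ ncard_inversions_comp_simpleReflection_lt hf (not_le.1 hs))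
      (finite_inversions_comp_simpleReflection hf s) rfl
    refine ⟨cs.simple s * w, ?_⟩
    rwa [map_mul, geometricRep_simple]

theorem mem_titsCone_iff_finite_inversions : f ∈ titsCone cs ↔ (inversions cs f).Finite := by
  rw [mem_titsCone_iff_exists_isDominant_comp]
  refine ⟨fun ⟨w, hw⟩ => ?_, exists_isDominant_comp_of_finite_inversions⟩
  have hempty : inversions cs (f ∘ₗ (geometricRep cs w).toLinearMap) = ∅ :=
    eq_empty_of_forall_notMem fun v hv => (hw.map_nonneg hv.1).not_gt hv.2
  have hfin := finite_inversions_comp_geometricRep (hempty ▸ finite_empty) w⁻¹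
  have hcomp : (f ∘ₗ (geometricRep cs w).toLinearMap) ∘ₗ (geometricRep cs w⁻¹).toLinearMap = f :=
    LinearMap.ext fun v => congrArg f (geometricRep_apply_inv_self w v)
  rwa [hcomp] at hfin

theorem titsCone_eq_univ [Finite W] [Finite B] : titsCone cs = univ := by
  refine eq_univ_of_forall fun f => mem_titsCone_iff_finite_inversions.2 ?_
  refine (finite_range fun p : W × B => geometricRep cs p.1 (simpleRoot p.2)).subset ?_
  rintro _ ⟨⟨⟨w, s, rfl⟩, -⟩, -⟩
  exact ⟨(w, s), rfl⟩

theorem add_smul_mem_titsCone (hf : f ∈ titsCone cs) (hg : g ∈ titsCone cs) {ε : ℝ} (hε : 0 ≤ ε) :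
    f + ε • g ∈ titsCone cs := by
  rw [mem_titsCone_iff_finite_inversions] at hf hg ⊢
  refine (hf.union hg).subset fun v ⟨hv, hneg⟩ => ?_
  by_contra! h
  rw [inversions, inversions, mem_union, not_or] at h
  have hfv : 0 ≤ f v := not_lt.1 fun hlt => h.1 ⟨hv, hlt⟩
  have hgv : 0 ≤ g v := not_lt.1 fun hlt => h.2 ⟨hv, hlt⟩
  exact hneg.not_ge (add_nonneg hfv (mul_nonneg hε hgv))

open Filter Topology in
theorem eventually_sign_add_smul_eq (hf : f ∈ titsCone cs) (hg : g ∈ titsCone cs) :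
    ∀ᶠ ε in 𝓝[>] (0 : ℝ), ∀ v ∈ roots cs, f v ≠ 0 →
      SignType.sign ((f + ε • g) v) = SignType.sign (f v) := by
  suffices h : ∀ᶠ ε in 𝓝[>] (0 : ℝ), ∀ v ∈ posRoots cs, f v ≠ 0 →
      SignType.sign ((f + ε • g) v) = SignType.sign (f v) by
    filter_upwards [h] with ε h v hv hfv
    refine (mem_posRoots_or_neg_mem_posRoots hv).elim (fun hv => h v hv hfv) fun hv => ?_
    simpa only [map_neg, Left.sign_neg, neg_inj] using h _ hv (by simpa using hfv)
  rw [mem_titsCone_iff_finite_inversions] at hf hg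
  have hsmall : ∀ᶠ ε in 𝓝[>] (0 : ℝ), ∀ v ∈ inversions cs f ∪ inversions cs g, f v ≠ 0 →
      SignType.sign ((f + ε • g) v) = SignType.sign (f v) := by
    refine (eventually_all_finite (hf.union hg)).2 fun v _ => eventually_imp_distrib_left.2
      fun hfv => eventually_nhdsWithin_of_eventually_nhds ?_
    have hcont : Continuous fun ε : ℝ => (f + ε • g) v := by
      simp only [LinearMap.add_apply, LinearMap.smul_apply, smul_eq_mul]
      fun_prop
    have hlim : Tendsto (fun ε : ℝ => (f + ε • g) v) (𝓝 0) (𝓝 (f v)) := by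
      simpa using hcont.tendsto 0
    have hsign := (continuousAt_sign_of_ne_zero hfv).tendsto.comp hlim
    rwa [nhds_discrete SignType, tendsto_pure] at hsign
  filter_upwards [hsmall, self_mem_nhdsWithin] with ε hsmall hε v hv hfv
  by_cases hinv : v ∈ inversions cs f ∪ inversions cs g
  · exact hsmall v hinv hfv
  · have hfv' : 0 < f v := lt_of_le_of_ne (not_lt.1 fun h => hinv (Or.inl ⟨hv, h⟩)) hfv.symm
    have hgv : 0 ≤ g v := not_lt.1 fun h => hinv (Or.inr ⟨hv, h⟩)
    rw [sign_pos hfv', sign_eq_one_iff]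
    exact add_pos_of_pos_of_nonneg hfv' (mul_nonneg (le_of_lt hε) hgv)

theorem exists_mem_titsCone_forall_roots (hf : f ∈ titsCone cs) (hg : g ∈ titsCone cs) :
    ∃ h ∈ titsCone cs, ∀ v ∈ roots cs,
      (h v = 0 ↔ f v = 0 ∧ g v = 0) ∧ (0 ≤ h v → 0 ≤ f v) := by
  obtain ⟨ε, hsign, hε⟩ :=
    ((eventually_sign_add_smul_eq hf hg).and self_mem_nhdsWithin).exists
  refine ⟨f + ε • g, add_smul_mem_titsCone hf hg (le_of_lt hε), fun v hv => ?_⟩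
  by_cases hfv : f v = 0
  · simp [hfv, (show 0 < ε from hε).ne']
  · have h := hsign v hv hfv
    rw [← sign_eq_zero_iff, ← sign_nonneg_iff, h, sign_eq_zero_iff, sign_nonneg_iff]
    simp [hfv]

theorem exists_mem_titsCone_forall_mem_finset (S : Finset (Module.Dual ℝ (B →₀ ℝ)))
    (hS : (S : Set (Module.Dual ℝ (B →₀ ℝ))) ⊆ titsCone cs) :
    ∃ h ∈ titsCone cs, ∀ v ∈ roots cs, h v = 0 ↔ ∀ f ∈ S, f v = 0 := by
  induction S using Finset.cons_induction with
  | empty => exact ⟨0, IsDominant.mem_titsCone fun _ => le_rfl, by simp⟩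
  | cons f S _ ih =>
    rw [Finset.coe_cons, insert_subset_iff] at hS
    obtain ⟨g, hg, hgS⟩ := ih hS.2
    obtain ⟨h, hh, hhv⟩ := exists_mem_titsCone_forall_roots hS.1 hg
    refine ⟨h, hh, fun v hv => ?_⟩
    rw [(hhv v hv).1, hgS v hv, Finset.forall_mem_cons]

end TitsCone

section ParabolicFlats

variable {B : Type*} {M : CoxeterMatrix B} {W : Type*} [Group W] {cs : CoxeterSystem M W}
  {f : Module.Dual ℝ (B →₀ ℝ)} {F G : Set (B →₀ ℝ)}

theorem IsCoxeterFlat.isParabolicFlat [Finite B] (hF : IsCoxeterFlat cs F) :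
    IsParabolicFlat cs F := by
  obtain _ | _ := finite_or_infinite W
  · exact ⟨hF.1, by rw [titsCone_eq_univ, inter_univ, Submodule.span_eq]⟩
  · exact hF.2 ‹_›

theorem IsParabolicFlat.exists_mem_titsCone [Finite B] (hF : IsParabolicFlat cs F) :
    ∃ f ∈ titsCone cs, {v ∈ posRoots cs | f v = 0} = F := by
  obtain ⟨S, hS, hspan⟩ := (Submodule.fg_span_iff_fg_span_finset_subset (R := ℝ)
    ((flatSpace F : Set (Module.Dual ℝ (B →₀ ℝ))) ∩ titsCone cs)).1 (IsNoetherian.noetherian _)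
  rw [hF.2] at hspan
  obtain ⟨f, hf, hfS⟩ := exists_mem_titsCone_forall_mem_finset S (hS.trans inter_subset_right)
  obtain ⟨hFE, hFclosed⟩ := isFlat_vectorMatroid_iff.1 hF.1
  refine ⟨f, hf, Subset.antisymm (fun v ⟨hv, hfv⟩ => hFclosed v hv ?_) fun v hv =>
    ⟨hFE hv, (hfS v (hFE hv).1).2 fun g hg =>
      (Submodule.mem_dualAnnihilator g).1 (hS hg).1 v (Submodule.subset_span hv)⟩⟩
  rw [← Subspace.forall_mem_dualAnnihilator_apply_eq_zero_iff]
  intro g hg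
  have hle : Submodule.span ℝ (S : Set (Module.Dual ℝ (B →₀ ℝ))) ≤
      LinearMap.ker (Module.Dual.eval ℝ (B →₀ ℝ) v) :=
    Submodule.span_le.2 ((hfS v hv.1).1 hfv)
  exact hle (hspan ▸ hg)

theorem sep_roots_eq_union_neg :
    {v ∈ roots cs | f v = 0} = {v ∈ posRoots cs | f v = 0} ∪ -{v ∈ posRoots cs | f v = 0} := by
  ext v
  simp only [mem_union, mem_neg, mem_ofPred_eq, map_neg, neg_eq_zero, ← or_and_right]
  refine and_congr_left fun _ => ⟨mem_posRoots_or_neg_mem_posRoots, ?_⟩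
  exact fun h => h.elim (fun h => h.1) fun h => neg_neg v ▸ neg_mem_roots h.1

theorem image_geometricRep_standardFlat_union_neg {w : W}
    (hf : IsDominant (f ∘ₗ (geometricRep cs w).toLinearMap)) :
    geometricRep cs w '' (standardFlat cs {s | f (geometricRep cs w (simpleRoot s)) = 0} ∪
        -standardFlat cs {s | f (geometricRep cs w (simpleRoot s)) = 0}) =
      {v ∈ posRoots cs | f v = 0} ∪ -{v ∈ posRoots cs | f v = 0} := by
  have hstd := hf.sep_posRoots_eq_standardFlat (cs := cs)
  simp only [LinearMap.comp_apply, LinearEquiv.coe_coe] at hstd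
  rw [← hstd, ← sep_roots_eq_union_neg]
  have hroots := sep_roots_eq_union_neg (cs := cs)
    (f := f ∘ₗ (geometricRep cs w).toLinearMap)
  simp only [LinearMap.comp_apply, LinearEquiv.coe_coe] at hroots
  rw [← hroots]
  ext v
  constructor
  · rintro ⟨u, ⟨hu, hfu⟩, rfl⟩
    exact ⟨geometricRep_mem_roots hu w, hfu⟩
  · rintro ⟨hv, hfv⟩
    refine ⟨geometricRep cs w⁻¹ v, ⟨geometricRep_mem_roots hv w⁻¹, ?_⟩,
      geometricRep_apply_inv_self w v⟩
    rwa [geometricRep_apply_inv_self]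

theorem IsParabolicFlat.exists_image_standardFlat_union_neg [Finite B]
    (hF : IsParabolicFlat cs F) (hG : IsParabolicFlat cs G) (hFG : F ⊆ G) :
    ∃ (w : W) (J K : Set B),
      geometricRep cs w '' (standardFlat cs J ∪ -standardFlat cs J) = F ∪ -F ∧
      geometricRep cs w '' (standardFlat cs K ∪ -standardFlat cs K) = G ∪ -G := by
  obtain ⟨f, hf, rfl⟩ := hF.exists_mem_titsCone
  obtain ⟨g, hg, rfl⟩ := hG.exists_mem_titsCone
  obtain ⟨h, hh, hroots⟩ := exists_mem_titsCone_forall_roots hg hf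
  obtain ⟨w, hw⟩ := mem_titsCone_iff_exists_isDominant_comp.1 hh
  have hgw : IsDominant (g ∘ₗ (geometricRep cs w).toLinearMap) := fun s =>
    (hroots _ (geometricRep_mem_roots (simpleRoot_mem_posRoots s).1 w)).2 (hw s)
  have hzero : {v ∈ posRoots cs | h v = 0} = {v ∈ posRoots cs | f v = 0} := by
    ext v
    refine and_congr_right fun hv => ?_
    rw [(hroots v hv.1).1, and_iff_right_of_imp]
    exact fun hfv => (hFG ⟨hv, hfv⟩).2
  rw [← hzero]
  exact ⟨w, _, _, image_geometricRep_standardFlat_union_neg hw,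
    image_geometricRep_standardFlat_union_neg hgw⟩

theorem isIndecomposableMod_comap_geometricRep_iff {P : Submodule ℝ (B →₀ ℝ)} {w : W} {K : Set B}
    (hK : geometricRep cs w '' (standardFlat cs K ∪ -standardFlat cs K) = G ∪ -G) :
    IsIndecomposableMod (P.comap (geometricRep cs w).toLinearMap) (standardFlat cs K) ↔
      IsIndecomposableMod P G := by
  rw [← isIndecomposableMod_union_neg, ← isIndecomposableMod_image_iff, hK,
    isIndecomposableMod_union_neg]

theorem comap_geometricRep_span {w : W} {J : Set B}
    (hJ : geometricRep cs w '' (standardFlat cs J ∪ -standardFlat cs J) = F ∪ -F) :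
    (Submodule.span ℝ F).comap (geometricRep cs w).toLinearMap =
      Finsupp.supported ℝ ℝ J := by
  have span_union_neg (E : Set (B →₀ ℝ)) :
      Submodule.span ℝ (E ∪ -E) = Submodule.span ℝ E := by
    rw [Submodule.span_union, Submodule.span_neg, sup_idem]
  rw [← span_union_neg F, ← hJ, ← LinearEquiv.coe_coe, Submodule.span_image,
    Submodule.comap_map_eq_of_injective (geometricRep cs w).injective, span_union_neg,
    span_standardFlat]

theorem matroidConnected_flatQuotient [Finite B] (hF : IsCoxeterFlat cs F)
    (hG : IsCoxeterFlat cs G) (hFG : F ⊂ G) (hconn : IsConnectedFlat cs G) :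
    MatroidConnected (flatQuotient cs G F) := by
  have hGE : G ⊆ posRoots cs := (isFlat_vectorMatroid_iff.1 hG.1).1
  obtain ⟨w, J, K, hJ, hK⟩ :=
    hF.isParabolicFlat.exists_image_standardFlat_union_neg hG.isParabolicFlat hFG.subset
  obtain ⟨hGne, hGind⟩ := (isConnectedFlat_iff hGE).1 hconn
  have hKne : K.Nonempty := by
    rw [← standardFlat_nonempty_iff (cs := cs), nonempty_iff_ne_empty]
    rintro hempty
    rw [hempty] at hK
    simp only [neg_empty, union_empty, image_empty] at hK
    exact hGne.ne_empty (subset_empty_iff.1 (hK ▸ subset_union_left))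
  have hKconn : ((diagram M).induce K).Connected := by
    refine connected_of_isIndecomposableMod_standardFlat (cs := cs) hKne ?_
    rwa [← isIndecomposableMod_comap_geometricRep_iff hK, Submodule.comap_bot,
      LinearEquiv.ker] at hGind
  refine matroidConnected_restrict_contract_vectorMatroid hF.1 hGE hFG ?_
  rw [← isIndecomposableMod_comap_geometricRep_iff hK, comap_geometricRep_span hJ]
  exact isIndecomposableMod_standardFlat (toFinite K) hKconn J

end ParabolicFlats

section PositiveFlats

variable {B : Type*} {M : CoxeterMatrix B} {W : Type*} [Group W] {cs : CoxeterSystem M W}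

theorem IsPositiveFlat.isCoxeterFlat [Finite B] {F : Set (B →₀ ℝ)} (hF : IsPositiveFlat cs F) :
    IsCoxeterFlat cs F := by
  obtain ⟨J, rfl⟩ := isPositiveFlat_iff.1 hF
  exact ⟨isFlat_standardFlat J, fun _ => isParabolicFlat_standardFlat J⟩

theorem bijOn_standardFlat : BijOn (standardFlat cs) univ {F | IsPositiveFlat cs F} :=
  ⟨fun J _ => isPositiveFlat_iff.2 ⟨J, rfl⟩, standardFlat_injective.injOn, fun _ hF =>
    (isPositiveFlat_iff.1 hF).imp fun J hJ => ⟨mem_univ J, hJ⟩⟩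

theorem bijOn_standardFlat_of_iff {p : Set B → Prop} {q : Set (B →₀ ℝ) → Prop}
    (h : ∀ J, p J ↔ q (standardFlat cs J)) :
    BijOn (standardFlat cs) {J | p J} {F | IsPositiveFlat cs F ∧ q F} := by
  refine ⟨fun J hJ => ⟨isPositiveFlat_iff.2 ⟨J, rfl⟩, (h J).1 hJ⟩, standardFlat_injective.injOn, ?_⟩
  rintro F ⟨hF, hq⟩
  obtain ⟨J, rfl⟩ := isPositiveFlat_iff.1 hF
  exact ⟨J, (h J).2 hq, rfl⟩

theorem isTube_iff_isConnectedFlat_standardFlat [Finite B] {J : Set B} :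
    IsTube (diagram M) J ↔
      IsConnectedFlat cs (standardFlat cs J) ∧ standardFlat cs J ≠ posRoots cs := by
  rw [isConnectedFlat_standardFlat_iff (toFinite J), ← standardFlat_univ,
    standardFlat_injective.ne_iff]
  exact ⟨fun h => ⟨h.2.2, h.1⟩, fun h => ⟨h.2, nonempty_coe_sort.1 h.1.nonempty, h.1⟩⟩

end PositiveFlats

end CoxeterFlats

open CoxeterFlats in
theorem mainTheorem4 {B : Type*} [Finite B] {M : CoxeterMatrix B} {W : Type*} [Group W]
    (cs : CoxeterSystem M W) :
    -- (i)
    (Set.BijOn (standardFlat cs) Set.univ {F | IsPositiveFlat cs F} ∧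
      ∀ F, IsPositiveFlat cs F → IsCoxeterFlat cs F) ∧
    -- (ii)
    (Set.BijOn (standardFlat cs) {J | ((diagram M).induce J).Connected}
        {F | IsPositiveFlat cs F ∧ IsConnectedFlat cs F} ∧
      Set.BijOn (standardFlat cs) {J | IsTube (diagram M) J}
        {F | IsPositiveFlat cs F ∧ IsConnectedFlat cs F ∧ F ≠ posRoots cs}) ∧
    -- (iii)
    IsCircuitousBase (rootMatroid cs) (Set.range simpleRoot) ∧
    -- (iv)
    (∀ F G, IsCoxeterFlat cs F → IsCoxeterFlat cs G → F ⊂ G → IsConnectedFlat cs G →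
      MatroidConnected (flatQuotient cs G F)) :=
  ⟨⟨bijOn_standardFlat, fun _ hF => hF.isCoxeterFlat⟩,
    ⟨bijOn_standardFlat_of_iff fun J => (isConnectedFlat_standardFlat_iff J.toFinite).symm,
      bijOn_standardFlat_of_iff fun _ => isTube_iff_isConnectedFlat_standardFlat⟩,
    isCircuitousBase_range_simpleRoot,
    fun _ _ => matroidConnected_flatQuotient⟩
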